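/- Let $d,K\ge 1$ be integers and let $\frac d2<s\le d$. Write $\mathbb T^d=\mathbb R^d/\mathbb Z^d$. The Sobolev space $W^{s,2}(\mathbb T^d)$ consists of all $w\in L^2(\mathbb T^d)$ with $\sum_{k\in\mathbb Z^d}|k|^{2s}|\widehat w(k)|^2<\infty$. For $2\le q\le\infty$, a matrix function $U\in[L^2(\mathbb T^d)]^{K\times K}$ belongs to the class $\mathfrak M_2^q(K)$ of matrix valued $(2,q)$-multipliers if $A\mapsto \mathcal F_K(U\mathcal F_K^{-1}A)$ is a bounded operator from $[\ell^2(\mathbb Z^d)]^K$ to $[\ell^q(\mathbb Z^d)]^K$, where $\mathcal F_K$ takes Fourier coefficients componentwise. "$W^{-1}\in\mathfrak M_2^q(K)$" means that $W(x)$ is invertible for almost every $x$ and that the function $x\mapsto W(x)^{-1}$ belongs to $\mathfrak M_2^q(K)$. "$\det W$ has a zero" means that $\det W$ has a continuous representative and that this representative vanishes at some point of $\mathbb T^d$. We use the conventions $\frac{d}{d-s}=\infty$ if $s=d$ and $\frac{2d}{d-2}=\infty$ if $d=2$. Let $\mathcal C$ be either of the following two classes of $K\times K$ complex matrix functions on $\mathbb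 T^d$: (a) all $W\in[L^1(\mathbb T^d)]^{K\times K}$ that are Hermitian almost everywhere and whose eigenvalues $\lambda_1(x)\ge\lambda_2(x)\ge\cdots\ge\lambda_K(x)$ satisfy $\lambda_k\in W^{s,2}(\mathbb T^d)$ for every $k=1,\dots,K$; (b) all $W\in[W^{s,2}(\mathbb T^d)]^{K\times K}$ that are Hermitian positive semidefinite almost everywhere. Then the following hold. (i) Suppose $s<\frac d2+1$. If $W\in\mathcal C$ and $\det W$ has a zero, then $W^{-1}\notin\mathfrak M_2^q(K)$ for every $q$ with $2\le q\le\frac{d}{d-s}$. Conversely, for every $q\in(\frac{d}{d-s},\infty]$ there exists $W\in\mathcal C$ such that $\det W$ has a zero and $W^{-1}\in\mathfrak M_2^q(K)$. (ii) Suppose $s=\frac d2+1$. If $W\in\mathcal C$ and $\det W$ has a zero, then $W^{-1}\notin\mathfrak M_2^q(K)$ for every $q$ with $2\le q<\frac{2d}{d-2}$. -/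

import Mathlib

open MeasureTheory
open scoped ENNReal Matrix ComplexOrder

noncomputable section

namespace SobolevMultiplier

/-- The torus `𝕋ᵈ = ℝᵈ / ℤᵈ`. -/
abbrev Torus (d : ℕ) : Type := UnitAddTorus (Fin d)

/-- Normalised Lebesgue measure on `𝕋ᵈ`, i.e. the product of the Haar probability measures on
`ℝ / ℤ`. -/
abbrev torusMeasure (d : ℕ) : Measure (Torus d) :=
  Measure.pi fun _ => AddCircle.haarAddCircle

/-- Mathlib's Fourier coefficient is the integral against the measure above. -/
theorem mFourierCoeff_eq {d : ℕ} (f : Torus d → ℂ) (n : Fin d → ℤ) :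
    UnitAddTorus.mFourierCoeff f n
      = ∫ x, UnitAddTorus.mFourier (-n) x • f x ∂torusMeasure d := rfl

/-- The Sobolev space `W^{s,2}(𝕋ᵈ)`, `s > 0`: square integrable functions `w` with
`∑ₖ |k|^{2s} |ŵ(k)|² < ∞`, where `|k|` is the Euclidean norm, so that
`|k|^{2s} = (∑ᵢ kᵢ²) ^ s`. -/
def MemSobolev {d : ℕ} (s : ℝ) (w : Torus d → ℂ) : Prop :=
  MemLp w 2 (torusMeasure d) ∧
    Summable fun k : Fin d → ℤ =>
      (∑ i, (k i : ℝ) ^ 2) ^ s * ‖UnitAddTorus.mFourierCoeff w k‖ ^ 2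

/-- `f` has a zero: `f` has a continuous representative (necessarily unique), and this
representative vanishes at some point. -/
def HasZero {d : ℕ} (f : Torus d → ℂ) : Prop :=
  ∃ g : Torus d → ℂ, Continuous g ∧ g =ᵐ[torusMeasure d] f ∧ ∃ x, g x = 0

/-- The `k`-th eigenvalue, in decreasing order and with multiplicity, of a Hermitian matrix
(and `0` if the matrix is not Hermitian). -/
def eigenvalueDesc {K : ℕ} (A : Matrix (Fin K) (Fin K) ℂ) (k : Fin K) : ℝ :=
  open Classical in
  if h : A.IsHermitian then h.eigenvalues₀ (Fin.cast (Fintype.card_fin K).symm k) else 0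

/-- The space `ℓ^q(ℤᵈ)` of complex sequences. -/
abbrev SeqSpace (d : ℕ) (q : ℝ≥0∞) : Type := lp (fun _ : Fin d → ℤ => ℂ) q

/-- The space `[ℓ^q(ℤᵈ)]^K`, with the norm `(∑ₖ ‖gₖ‖_q ^ q) ^ (1 / q)` (the maximum of the
`‖gₖ‖_∞` if `q = ∞`). -/
abbrev VecSeqSpace (d K : ℕ) (q : ℝ≥0∞) : Type := PiLp q fun _ : Fin K => SeqSpace d q

/-- The inverse Fourier transform `ℓ²(ℤᵈ) → L²(𝕋ᵈ)`, `a ↦ ∑ₙ a(n) e^{2πi⟨n,x⟩}`. -/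
def invFourier {d : ℕ} (a : SeqSpace d 2) : Torus d → ℂ :=
  ((UnitAddTorus.mFourierBasis (d := Fin d)).repr.symm a :)

/-- The operator `T_U A = 𝓕_K (U 𝓕_K⁻¹ A)`, for `A ∈ [ℓ²(ℤᵈ)]^K`: its `i`-th component, evaluated
at `n ∈ ℤᵈ`. -/
def multiplierOp {d K : ℕ} (U : Torus d → Matrix (Fin K) (Fin K) ℂ) (A : VecSeqSpace d K 2)
    (i : Fin K) (n : Fin d → ℤ) : ℂ :=
  UnitAddTorus.mFourierCoeff (fun x => (U x *ᵥ fun j => invFourier (A j) x) i) n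

/-- The class `𝔐_2^q(K)` of matrix valued `(2,q)`-multipliers: `U ∈ [L²(𝕋ᵈ)]^{K×K}` such that `T_U`
is a bounded operator from `[ℓ²(ℤᵈ)]^K` to `[ℓ^q(ℤᵈ)]^K`. -/
def IsMatrixMultiplier {d K : ℕ} (q : ℝ≥0∞) (U : Torus d → Matrix (Fin K) (Fin K) ℂ) : Prop :=
  (∀ i j, MemLp (fun x => U x i j) 2 (torusMeasure d)) ∧
    ∃ C : ℝ, ∀ A : VecSeqSpace d K 2, ∃ B : VecSeqSpace d K q,
      (∀ i n, B i n = multiplierOp U A i n) ∧ ‖B‖ ≤ C * ‖A‖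

/-- `W⁻¹ ∈ 𝔐_2^q(K)`: the matrices `W x` are invertible for almost every `x`, and their inverses
form a matrix valued `(2,q)`-multiplier. -/
def InverseIsMultiplier {d K : ℕ} (q : ℝ≥0∞) (W : Torus d → Matrix (Fin K) (Fin K) ℂ) : Prop :=
  ∃ U : Torus d → Matrix (Fin K) (Fin K) ℂ,
    (∀ᵐ x ∂torusMeasure d, W x * U x = 1) ∧ IsMatrixMultiplier q U

/-- `W ∈ [L¹(𝕋ᵈ)]^{K×K}` is Hermitian and its ordered eigenvalues `λ₁ ≥ ⋯ ≥ λ_K` all lie in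
`W^{s,2}(𝕋ᵈ)`. -/
def HermitianWithSobolevEigenvalues {d K : ℕ} (s : ℝ)
    (W : Torus d → Matrix (Fin K) (Fin K) ℂ) : Prop :=
  (∀ i j, Integrable (fun x => W x i j) (torusMeasure d)) ∧
    (∀ᵐ x ∂torusMeasure d, (W x).IsHermitian) ∧
    ∀ k, MemSobolev s fun x => (eigenvalueDesc (W x) k : ℂ)

/-- `W` is nonnegative, i.e. Hermitian positive semidefinite almost everywhere, and
`W ∈ [W^{s,2}(𝕋ᵈ)]^{K×K}`. -/
def NonnegWithSobolevEntries {d K : ℕ} (s : ℝ)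
    (W : Torus d → Matrix (Fin K) (Fin K) ℂ) : Prop :=
  (∀ᵐ x ∂torusMeasure d, (W x).PosSemidef) ∧
    ∀ i j, MemSobolev s fun x => W x i j

end SobolevMultiplier

end

open SobolevMultiplier

/-!
Suppose `det W` vanishes at `x₀`. Membership in `W^{s,2}` forces the smallest singular value of
`W x` to be `o(|x - x₀|^{s - d/2})`: apply Cauchy–Schwarz to the Fourier series after splitting off
finitely many frequencies. So the indicator of a ball of radius `ρ` about `x₀` is a sum of terms
`Uᵢⱼ fᵢⱼ` with `U = W⁻¹` and `‖fᵢⱼ‖₂ = o(ρ^s)`, while its Fourier coefficients are `≳ ρ^d` for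
`|n| ≲ 1/ρ`, so that their `ℓ^q` norm is `≳ ρ^{d - d/q}`. As `ρ → 0` this contradicts boundedness of
the multiplier when `d - d/q ≤ s`; having `o` rather than `O` is what gives the endpoint
`q = d/(d - s)`. The case `s = d/2 + 1` follows from `W^{s,2} ⊂ W^{t,2}` for `t < s`.

For sharpness take `W = w · 1` with `w x = ∑ₖ |k|^{-(d+α)} (1 - cos 2π⟨k, x⟩) ≳ |x|^α` and `α`
slightly larger than `s - d/2`. Then `1/w ∈ L^p` for `α p < d`, and `L^p` functions with
`1/p < 1/2 - 1/q` are `(2,q)`-multipliers, by a dyadic decomposition into level sets.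
-/

noncomputable section

namespace SobolevMultiplier

open UnitAddTorus Filter Topology

/-! ### Lattice sums -/

lemma one_le_norm_of_ne_zero {ι : Type*} [Fintype ι] {k : ι → ℤ} (hk : k ≠ 0) : 1 ≤ ‖k‖ := by
  obtain ⟨i, hi⟩ := Function.ne_iff.mp hk
  refine le_trans ?_ (norm_le_pi_norm k i)
  rw [Int.norm_eq_abs]
  exact_mod_cast Int.one_le_abs hi

lemma encard_ne_zero_norm_lt_le (ι : Type*) [Fintype ι] (R : ℝ) :
    ({k : ι → ℤ | k ≠ 0 ∧ ‖k‖ < R}.encard : ℝ≥0∞) ≤ ENNReal.ofReal ((3 * R) ^ Fintype.card ι) := by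
  classical
  rcases le_or_gt R 1 with hR | hR
  · have : {k : ι → ℤ | k ≠ 0 ∧ ‖k‖ < R} = ∅ := by
      ext k
      simpa using fun hk => hR.trans (one_le_norm_of_ne_zero hk)
    simp [this]
  · let B : Finset (ι → ℤ) := Fintype.piFinset fun _ => Finset.Icc (-⌊R⌋) ⌊R⌋
    have hsub : {k : ι → ℤ | k ≠ 0 ∧ ‖k‖ < R} ⊆ B := by
      rintro k ⟨-, hk⟩
      simp only [B, Finset.mem_coe, Fintype.mem_piFinset, Finset.mem_Icc, ← abs_le]
      intro i
      rw [Int.le_floor, Int.cast_abs, ← Int.norm_eq_abs]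
      exact (norm_le_pi_norm k i).trans hk.le
    have hcard : (B.card : ℝ) ≤ (3 * R) ^ Fintype.card ι := by
      have h0 : 0 ≤ ⌊R⌋ := Int.floor_nonneg.mpr (by linarith)
      have h1 : ((⌊R⌋ + 1 - -⌊R⌋).toNat : ℝ) = ⌊R⌋ + 1 + ⌊R⌋ := by
        rw [← Int.cast_natCast, Int.toNat_of_nonneg (by linarith)]
        push_cast; ring
      simp only [B, Fintype.card_piFinset, Int.card_Icc, Finset.prod_const, Finset.card_univ,
        Nat.cast_pow, h1]
      gcongr
      linarith [Int.floor_le R]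
    calc (({k : ι → ℤ | k ≠ 0 ∧ ‖k‖ < R}.encard : ℕ∞) : ℝ≥0∞) ≤ (B.card : ℝ≥0∞) := by
          exact_mod_cast (Set.encard_mono hsub).trans_eq (Set.encard_coe_eq_coe_finsetCard B)
      _ ≤ _ := by
          rw [← ENNReal.ofReal_natCast]
          exact ENNReal.ofReal_le_ofReal hcard

lemma tsum_comp_mul_norm_le_tsum_dyadic {ι : Type*} [Fintype ι] {g : ℝ → ℝ≥0∞} {G : ℤ → ℝ≥0∞}
    (h0 : g 0 = 0) (hg : ∀ (j : ℤ) (t : ℝ), 2 ^ j ≤ t → t < 2 ^ (j + 1) → g t ≤ G j)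
    {ρ : ℝ} (hρ : 0 < ρ) :
    ∑' k : ι → ℤ, g (ρ * ‖k‖)
      ≤ ∑' j : ℤ, ENNReal.ofReal ((6 * 2 ^ j / ρ) ^ Fintype.card ι) * G j := by
  rw [← ENNReal.tsum_fiberwise _ (fun k : ι → ℤ => Int.log 2 (ρ * ‖k‖))]
  refine ENNReal.tsum_le_tsum fun j => ?_
  set S : Set (ι → ℤ) := {k | k ≠ 0 ∧ ‖k‖ < 2 ^ (j + 1) / ρ}
  have hshell : ∀ k, ((fun k : ι → ℤ => Int.log 2 (ρ * ‖k‖)) ⁻¹' {j}).indicator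
      (fun k => g (ρ * ‖k‖)) k ≤ S.indicator (fun _ => G j) k := by
    refine Set.indicator_le fun k hk => ?_
    rcases eq_or_ne k 0 with rfl | hk0
    · simp [h0]
    have hpos : 0 < ρ * ‖k‖ := by positivity
    have hk : Int.log 2 (ρ * ‖k‖) = j := hk
    have hlt : ρ * ‖k‖ < 2 ^ (j + 1) := by
      exact_mod_cast hk ▸ Int.lt_zpow_succ_log_self Nat.one_lt_two (ρ * ‖k‖)
    rw [Set.indicator_of_mem (show k ∈ S from ⟨hk0, by rwa [lt_div_iff₀' hρ]⟩)]
    exact hg j _ (by exact_mod_cast hk ▸ Int.zpow_log_le_self Nat.one_lt_two hpos) hlt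
  calc _ = ∑' k, ((fun k : ι → ℤ => Int.log 2 (ρ * ‖k‖)) ⁻¹' {j}).indicator
            (fun k => g (ρ * ‖k‖)) k := tsum_subtype _ (fun k => g (ρ * ‖k‖))
    _ ≤ ∑' k, S.indicator (fun _ => G j) k := ENNReal.tsum_le_tsum hshell
    _ = S.encard * G j := by rw [← tsum_subtype, ENNReal.tsum_set_const]
    _ ≤ _ := by
      gcongr
      refine (encard_ne_zero_norm_lt_le ι _).trans_eq ?_
      rw [zpow_add_one₀ two_ne_zero]
      ring_nf

lemma summable_and_tsum_comp_mul_norm_le {ι : Type*} [Fintype ι] {g : ℝ → ℝ} {G : ℤ → ℝ}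
    (h0 : g 0 = 0) (hg0 : ∀ t, 0 ≤ t → 0 ≤ g t)
    (hg : ∀ (j : ℤ) (t : ℝ), 2 ^ j ≤ t → t < 2 ^ (j + 1) → g t ≤ G j)
    (hG : Summable fun j : ℤ => (6 * 2 ^ j) ^ Fintype.card ι * G j) {ρ : ℝ} (hρ : 0 < ρ) :
    (Summable fun k : ι → ℤ => g (ρ * ‖k‖)) ∧ ∑' k : ι → ℤ, g (ρ * ‖k‖)
      ≤ (∑' j : ℤ, (6 * 2 ^ j) ^ Fintype.card ι * G j) * (ρ ^ Fintype.card ι)⁻¹ := by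
  have hG0 (j : ℤ) : 0 ≤ G j :=
    (hg0 _ (by positivity)).trans (hg j _ le_rfl (zpow_lt_zpow_right₀ one_lt_two (lt_add_one j)))
  have hgk (k : ι → ℤ) : 0 ≤ g (ρ * ‖k‖) := hg0 _ (by positivity)
  have hle : ∑' k : ι → ℤ, ENNReal.ofReal (g (ρ * ‖k‖)) ≤ ENNReal.ofReal
      ((∑' j : ℤ, (6 * 2 ^ j) ^ Fintype.card ι * G j) * (ρ ^ Fintype.card ι)⁻¹) := by
    refine (tsum_comp_mul_norm_le_tsum_dyadic (g := fun t => ENNReal.ofReal (g t)) (by simp [h0])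
      (fun j t h₁ h₂ => ENNReal.ofReal_le_ofReal (hg j t h₁ h₂)) hρ).trans_eq ?_
    rw [← tsum_mul_right, ENNReal.ofReal_tsum_of_nonneg
      (fun j => by have := hG0 j; positivity) (hG.mul_right _)]
    refine tsum_congr fun j => ?_
    rw [← ENNReal.ofReal_mul (by positivity), div_pow]
    ring_nf
  have hsum : Summable fun k : ι → ℤ => g (ρ * ‖k‖) :=
    (ENNReal.summable_toReal (ne_top_of_le_ne_top ENNReal.ofReal_ne_top hle)).congr
      fun k => ENNReal.toReal_ofReal (hgk k)
  refine ⟨hsum, ?_⟩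
  rwa [← ENNReal.ofReal_tsum_of_nonneg hgk hsum, ENNReal.ofReal_le_ofReal_iff
    (mul_nonneg (tsum_nonneg fun j => by have := hG0 j; positivity) (by positivity))] at hle

lemma summable_zpow_mul_min_sq {c : ℝ} (h0 : 0 < c) (h2 : c < 2) :
    Summable fun j : ℤ => (2 : ℝ) ^ (-c * j) * min 1 ((2 : ℝ) ^ j) ^ 2 := by
  have hgeom {e : ℝ} (he : e < 0) : Summable fun n : ℕ => (2 : ℝ) ^ (e * n) := by
    simp_rw [Real.rpow_mul zero_le_two, Real.rpow_natCast]
    exact summable_geometric_of_lt_one (by positivity)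
      (Real.rpow_lt_one_of_one_lt_of_neg one_lt_two he)
  apply Summable.of_nat_of_neg
  · refine (hgeom (neg_lt_zero.mpr h0)).congr fun n => ?_
    rw [min_eq_left (by rw [zpow_natCast]; exact one_le_pow₀ one_le_two)]
    simp
  · refine (hgeom (sub_neg.mpr h2)).congr fun n => ?_
    rw [min_eq_right (zpow_le_one_of_nonpos₀ one_le_two (by simp)), ← Real.rpow_intCast,
      ← Real.rpow_mul_natCast zero_le_two, ← Real.rpow_add two_pos]
    congr 1; push_cast; ring

lemma rpow_mul_min_sq_le {s t : ℝ} (hs : 0 < s) {j : ℤ} (h₁ : 2 ^ j ≤ t) (h₂ : t < 2 ^ (j + 1)) :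
    t ^ (-(2 * s)) * min 1 t ^ 2 ≤ 4 * ((2 : ℝ) ^ (-(2 * s) * j) * min 1 ((2 : ℝ) ^ j) ^ 2) := by
  have hj : (0 : ℝ) < 2 ^ j := by positivity
  have hpow : t ^ (-(2 * s)) ≤ (2 : ℝ) ^ (-(2 * s) * j) := by
    rw [mul_comm _ (j : ℝ), Real.rpow_mul zero_le_two, Real.rpow_intCast]
    exact Real.rpow_le_rpow_of_nonpos hj h₁ (by linarith)
  have hmin : min 1 t ≤ 2 * min 1 ((2 : ℝ) ^ j) := by
    rw [mul_min_of_nonneg _ _ zero_le_two]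
    refine min_le_min (by norm_num) ?_
    rw [zpow_add_one₀ two_ne_zero] at h₂
    linarith
  have ht : 0 < t := hj.trans_le h₁
  calc _ ≤ (2 : ℝ) ^ (-(2 * s) * j) * (2 * min 1 ((2 : ℝ) ^ j)) ^ 2 := by gcongr
    _ = _ := by ring

lemma exists_tsum_rpow_mul_min_sq_le {ι : Type*} [Fintype ι] {s : ℝ}
    (hs : (Fintype.card ι : ℝ) / 2 < s) (hs1 : s < (Fintype.card ι : ℝ) / 2 + 1) :
    ∃ C : ℝ, ∀ ρ > 0,
      (Summable fun k : ι → ℤ => ‖k‖ ^ (-(2 * s)) * min 1 (ρ * ‖k‖) ^ 2) ∧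
      ∑' k : ι → ℤ, ‖k‖ ^ (-(2 * s)) * min 1 (ρ * ‖k‖) ^ 2
        ≤ C * ρ ^ (2 * s - Fintype.card ι) := by
  set n := Fintype.card ι
  have hs0 : 0 < s := lt_of_le_of_lt (by positivity) hs
  set G : ℤ → ℝ := fun j =>
    (6 * 2 ^ j) ^ n * (4 * ((2 : ℝ) ^ (-(2 * s) * j) * min 1 ((2 : ℝ) ^ j) ^ 2)) with hG_def
  have hG : Summable G := by
    refine ((summable_zpow_mul_min_sq (c := 2 * s - n) (by linarith) (by linarith)).mul_left
      (4 * 6 ^ n)).congr fun j => ?_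
    have : (2 : ℝ) ^ (-(2 * s - n) * j) = (2 : ℝ) ^ (-(2 * s) * j) * ((2 : ℝ) ^ j) ^ n := by
      rw [← Real.rpow_intCast, ← Real.rpow_mul_natCast zero_le_two, ← Real.rpow_add two_pos]
      congr 1; ring
    rw [this, hG_def]
    ring
  refine ⟨∑' j, G j, fun ρ hρ => ?_⟩
  obtain ⟨hsum, hle⟩ := summable_and_tsum_comp_mul_norm_le (ι := ι)
    (g := fun t => t ^ (-(2 * s)) * min 1 t ^ 2) (by simp) (fun t ht => by positivity)
    (fun j t => rpow_mul_min_sq_le hs0) hG hρ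
  have hscale (k : ι → ℤ) : ‖k‖ ^ (-(2 * s)) * min 1 (ρ * ‖k‖) ^ 2
      = ρ ^ (2 * s) * ((ρ * ‖k‖) ^ (-(2 * s)) * min 1 (ρ * ‖k‖) ^ 2) := by
    rw [Real.mul_rpow hρ.le (norm_nonneg k), ← mul_assoc, ← mul_assoc, ← Real.rpow_add hρ]
    simp
  simp_rw [hscale, tsum_mul_left, Real.rpow_sub hρ, Real.rpow_natCast]
  refine ⟨hsum.mul_left _, (mul_le_mul_of_nonneg_left hle (by positivity)).trans_eq ?_⟩
  ring

lemma summable_norm_rpow_neg {ι : Type*} [Fintype ι] {t : ℝ} (ht : (Fintype.card ι : ℝ) < t) :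
    Summable fun k : ι → ℤ => ‖k‖ ^ (-t) := by
  obtain ⟨s, hs, hst, hs1⟩ : ∃ s : ℝ, (Fintype.card ι : ℝ) / 2 < s ∧ s ≤ t / 2 ∧
      s < (Fintype.card ι : ℝ) / 2 + 1 :=
    ⟨min (t / 2) (Fintype.card ι / 2 + 1 / 2), lt_min (by linarith) (by linarith),
      min_le_left _ _, (min_le_right _ _).trans_lt (by linarith)⟩
  obtain ⟨C, hC⟩ := exists_tsum_rpow_mul_min_sq_le hs hs1
  refine (hC 1 one_pos).1.of_nonneg_of_le (fun k => by positivity) fun k => ?_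
  rcases eq_or_ne k 0 with rfl | hk
  · have : 0 < t := lt_of_le_of_lt (by positivity) ht
    simp [Real.zero_rpow, this.ne']
  · have h1 := one_le_norm_of_ne_zero hk
    rw [one_mul, min_eq_left h1, one_pow, mul_one]
    exact Real.rpow_le_rpow_of_exponent_le h1 (by linarith)

/-! ### Fourier series on the torus -/

lemma norm_mFourier_apply {ι : Type*} [Fintype ι] (n : ι → ℤ) (x : UnitAddTorus ι) :
    ‖mFourier n x‖ = 1 := by
  simp only [mFourier, ContinuousMap.coe_mk, norm_prod, fourier_apply, Circle.norm_coe,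
    Finset.prod_const_one]

lemma mFourier_sub_mul {ι : Type*} [Fintype ι] (n : ι → ℤ) (x y : UnitAddTorus ι) :
    mFourier n (x - y) * mFourier n y = mFourier n x := by
  simp only [mFourier, ContinuousMap.coe_mk, ← Finset.prod_mul_distrib]
  refine Finset.prod_congr rfl fun i _ => ?_
  rw [fourier_apply, fourier_apply, fourier_apply, ← Circle.coe_mul, ← AddCircle.toCircle_add,
    ← smul_add, Pi.sub_apply, sub_add_cancel]

lemma exists_coe_eq_abs_eq_norm (z : UnitAddCircle) :
    ∃ t : ℝ, (t : UnitAddCircle) = z ∧ |t| = ‖z‖ := by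
  induction z using QuotientAddGroup.induction_on with
  | H x =>
    refine ⟨x - round x, ?_, UnitAddCircle.norm_eq.symm⟩
    rw [AddCircle.coe_sub, sub_eq_self, AddCircle.coe_eq_zero_iff]
    exact ⟨round x, by simp⟩

lemma norm_mFourier_sub_one_le {ι : Type*} [Fintype ι] (n : ι → ℤ) (x : UnitAddTorus ι) :
    ‖mFourier n x - 1‖ ≤ 2 * Real.pi * Fintype.card ι * (‖n‖ * ‖x‖) := by
  choose t ht ht' using fun i => exists_coe_eq_abs_eq_norm (x i)
  have hexp : mFourier n x = Complex.exp (Complex.I * (2 * Real.pi * ∑ i, n i * t i : ℝ)) := by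
    simp only [mFourier, ContinuousMap.coe_mk]
    push_cast
    rw [Finset.mul_sum, Finset.mul_sum, Complex.exp_sum]
    refine Finset.prod_congr rfl fun i _ => ?_
    rw [← ht i, fourier_coe_apply]
    congr 1
    push_cast; ring
  have hphase : ‖∑ i, (n i : ℝ) * t i‖ ≤ Fintype.card ι * (‖n‖ * ‖x‖) := by
    refine (norm_sum_le _ _).trans ?_
    refine (Finset.sum_le_card_nsmul _ _ (‖n‖ * ‖x‖) fun i _ => ?_).trans (by simp)
    rw [norm_mul, Int.norm_cast_real, Real.norm_eq_abs (t i), ht']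
    exact mul_le_mul (norm_le_pi_norm n i) (norm_le_pi_norm x i) (norm_nonneg _) (norm_nonneg _)
  rw [hexp]
  refine Real.norm_exp_I_mul_ofReal_sub_one_le.trans ?_
  rw [norm_mul, Real.norm_of_nonneg (by positivity)]
  calc _ ≤ 2 * Real.pi * (Fintype.card ι * (‖n‖ * ‖x‖)) := by gcongr
    _ = _ := by ring

lemma norm_mFourier_sub_le {ι : Type*} [Fintype ι] (n : ι → ℤ) (x y : UnitAddTorus ι) :
    ‖mFourier n x - mFourier n y‖ ≤ 2 * Real.pi * Fintype.card ι * (‖n‖ * ‖x - y‖) := by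
  rw [← mFourier_sub_mul n x y, ← sub_one_mul, norm_mul, norm_mFourier_apply, mul_one]
  exact norm_mFourier_sub_one_le n _

lemma norm_mFourier_sub_le_mul_min {ι : Type*} [Fintype ι] (n : ι → ℤ) (x y : UnitAddTorus ι) :
    ‖mFourier n x - mFourier n y‖
      ≤ (2 + 2 * Real.pi * Fintype.card ι) * min 1 (‖x - y‖ * ‖n‖) := by
  have htwo : ‖mFourier n x - mFourier n y‖ ≤ 2 := by
    refine (norm_sub_le _ _).trans ?_
    rw [norm_mFourier_apply, norm_mFourier_apply, one_add_one_eq_two]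
  have hcard : 0 ≤ 2 * Real.pi * Fintype.card ι := by positivity
  rw [mul_min_of_nonneg _ _ (by positivity)]
  refine le_min (by linarith) ((norm_mFourier_sub_le n x y).trans ?_)
  rw [mul_comm ‖n‖]
  gcongr
  linarith

lemma mFourierCoeff_congr_ae {d : ℕ} {f g : Torus d → ℂ} (h : f =ᵐ[torusMeasure d] g)
    (n : Fin d → ℤ) : mFourierCoeff f n = mFourierCoeff g n := by
  rw [mFourierCoeff_eq, mFourierCoeff_eq]
  exact integral_congr_ae (h.mono fun x hx => by simp only [hx])

lemma mFourierCoeff_invFourier {d : ℕ} (a : SeqSpace d 2) (n : Fin d → ℤ) :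
    mFourierCoeff (invFourier a) n = a n := by
  rw [invFourier, ← mFourierBasis_repr, LinearIsometryEquiv.apply_symm_apply]

lemma exists_continuousMap_of_summable_mFourierCoeff {d : ℕ} {w : Torus d → ℂ}
    (hw : MemLp w 2 (torusMeasure d)) (hsum : Summable fun k => ‖mFourierCoeff w k‖) :
    ∃ F : C(Torus d, ℂ), F =ᵐ[torusMeasure d] w ∧
      ∀ x, HasSum (fun k => mFourierCoeff w k * mFourier k x) (F x) := by
  have hF : Summable fun k => mFourierCoeff w k • (mFourier k : C(Torus d, ℂ)) :=
    .of_norm (by simpa only [norm_smul, mFourier_norm, mul_one] using hsum)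
  refine ⟨∑' k, mFourierCoeff w k • mFourier k, ?_, fun x => ?_⟩
  · have hL2 := hasSum_mFourier_series_L2 (hw.toLp w)
    simp only [mFourierCoeff_congr_ae hw.coeFn_toLp] at hL2
    have huniq := ((ContinuousMap.toLp (E := ℂ) 2 (torusMeasure d) ℂ).hasSum hF.hasSum).unique
      (by simpa only [map_smul] using! hL2)
    have htoLp := ContinuousMap.coeFn_toLp (p := 2) (𝕜 := ℂ) (torusMeasure d)
      (∑' k, mFourierCoeff w k • (mFourier k : C(Torus d, ℂ)))
    rw [huniq] at htoLp
    exact htoLp.symm.trans hw.coeFn_toLp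
  · simpa only [map_smul] using! (ContinuousMap.evalCLM ℂ x).hasSum hF.hasSum

lemma exists_continuousMap_hasSum_mFourier {d : ℕ} {c : (Fin d → ℤ) → ℂ}
    (hc : Summable fun k => ‖c k‖) :
    ∃ F : C(Torus d, ℂ), (∀ n, mFourierCoeff F n = c n) ∧
      ∀ x, HasSum (fun k => c k * mFourier k x) (F x) := by
  have hc1 : Memℓp c 1 := memℓp_gen (by simpa using hc)
  let a : SeqSpace d 2 := ⟨c, hc1.of_exponent_ge one_le_two⟩
  have ha (n : Fin d → ℤ) : mFourierCoeff (invFourier a) n = c n := mFourierCoeff_invFourier a n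
  obtain ⟨F, hFa, hF⟩ := exists_continuousMap_of_summable_mFourierCoeff (w := invFourier a)
    (Lp.memLp _) (by simpa only [ha] using hc)
  simp only [ha] at hF
  exact ⟨F, fun n => (mFourierCoeff_congr_ae hFa n).trans (ha n), hF⟩

/-! ### Continuity of Sobolev functions -/

lemma sq_norm_le_sum_sq {ι : Type*} [Fintype ι] (k : ι → ℤ) : ‖k‖ ^ 2 ≤ ∑ i, (k i : ℝ) ^ 2 := by
  have h0 : 0 ≤ ∑ i, (k i : ℝ) ^ 2 := by positivity
  rw [← Real.le_sqrt (norm_nonneg _) h0, pi_norm_le_iff_of_nonneg (Real.sqrt_nonneg _)]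
  intro i
  apply Real.le_sqrt_of_sq_le
  rw [Int.norm_eq_abs, sq_abs]
  exact Finset.single_le_sum (f := fun i => (k i : ℝ) ^ 2) (fun _ _ => by positivity)
    (Finset.mem_univ i)

lemma summable_mul_and_tsum_mul_le_sqrt {ι : Type*} {f g : ι → ℝ} (hf : ∀ i, 0 ≤ f i)
    (hg : ∀ i, 0 ≤ g i) (hf2 : Summable fun i => f i ^ 2) (hg2 : Summable fun i => g i ^ 2) :
    (Summable fun i => f i * g i) ∧
      ∑' i, f i * g i ≤ √(∑' i, f i ^ 2) * √(∑' i, g i ^ 2) := by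
  have h := Real.summable_and_inner_le_Lp_mul_Lq_tsum_of_nonneg Real.HolderConjugate.two_two hf hg
    (by simpa using hf2) (by simpa using hg2)
  simpa [Real.sqrt_eq_rpow] using h

lemma exists_tsum_min_mul_le {ι : Type*} [Fintype ι] {s : ℝ}
    (hs : (Fintype.card ι : ℝ) / 2 < s) (hs1 : s < (Fintype.card ι : ℝ) / 2 + 1) :
    ∃ C : ℝ, ∀ a : (ι → ℤ) → ℝ, (∀ k, 0 ≤ a k) → (Summable fun k => ‖k‖ ^ (2 * s) * a k ^ 2) →
      ∀ ρ > 0, (Summable fun k => min 1 (ρ * ‖k‖) * a k) ∧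
        ∀ S : Set (ι → ℤ), ∑' k : S, min 1 (ρ * ‖(k : ι → ℤ)‖) * a k
          ≤ C * ρ ^ (s - Fintype.card ι / 2) * √(∑' k : S, ‖(k : ι → ℤ)‖ ^ (2 * s) * a k ^ 2) := by
  obtain ⟨C, hC⟩ := exists_tsum_rpow_mul_min_sq_le hs hs1
  refine ⟨√C, fun a ha hsum ρ hρ => ?_⟩
  obtain ⟨hker, hker_le⟩ := hC ρ hρ
  have hsq (k : ι → ℤ) (t : ℝ) : (‖k‖ ^ t) ^ 2 = ‖k‖ ^ (2 * t) := by
    rw [mul_comm, ← Real.rpow_mul_natCast (norm_nonneg k), Nat.cast_ofNat]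
  have hf (k : ι → ℤ) : (‖k‖ ^ (-s) * min 1 (ρ * ‖k‖)) ^ 2
      = ‖k‖ ^ (-(2 * s)) * min 1 (ρ * ‖k‖) ^ 2 := by rw [mul_pow, hsq, mul_neg]
  have hg (k : ι → ℤ) : (‖k‖ ^ s * a k) ^ 2 = ‖k‖ ^ (2 * s) * a k ^ 2 := by rw [mul_pow, hsq]
  have hfg (k : ι → ℤ) : ‖k‖ ^ (-s) * min 1 (ρ * ‖k‖) * (‖k‖ ^ s * a k)
      = min 1 (ρ * ‖k‖) * a k := by
    rcases eq_or_ne k 0 with rfl | hk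
    · simp
    · have := norm_pos_iff.mpr hk
      rw [Real.rpow_neg (norm_nonneg k)]
      field_simp
  have hf0 (k : ι → ℤ) : 0 ≤ ‖k‖ ^ (-s) * min 1 (ρ * ‖k‖) := by positivity
  have hg0 (k : ι → ℤ) : 0 ≤ ‖k‖ ^ s * a k := mul_nonneg (by positivity) (ha k)
  have hf2 := hker.congr fun k => (hf k).symm
  have hg2 := hsum.congr fun k => (hg k).symm
  refine ⟨(summable_mul_and_tsum_mul_le_sqrt hf0 hg0 hf2 hg2).1.congr hfg, fun S => ?_⟩
  have hCS := (summable_mul_and_tsum_mul_le_sqrt (fun k : S => hf0 k) (fun k => hg0 k)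
    (hf2.subtype S) (hg2.subtype S)).2
  simp only [hf, hg, hfg] at hCS
  refine hCS.trans ?_
  gcongr
  calc _ ≤ √(C * ρ ^ (2 * s - Fintype.card ι)) := Real.sqrt_le_sqrt
        ((hker.tsum_subtype_le _ S fun k => by positivity).trans hker_le)
    _ = √C * ρ ^ (s - Fintype.card ι / 2) := by
        rw [Real.sqrt_mul' _ (by positivity), Real.sqrt_eq_rpow (ρ ^ _), ← Real.rpow_mul hρ.le]
        congr 2; ring

lemma isLittleO_id_rpow {β : ℝ} (hβ : β < 1) :
    (fun ρ : ℝ => ρ) =o[𝓝[>] 0] fun ρ => ρ ^ β := by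
  have hlim : Tendsto (fun ρ : ℝ => ρ ^ (1 - β)) (𝓝[>] 0) (𝓝 0) := by
    have := (Real.continuousAt_rpow_const 0 (1 - β) (.inr (by linarith))).tendsto
    rw [Real.zero_rpow (by linarith)] at this
    exact this.mono_left nhdsWithin_le_nhds
  refine (((Asymptotics.isLittleO_one_iff ℝ).mpr hlim).mul_isBigO
    (Asymptotics.isBigO_refl (fun ρ : ℝ => ρ ^ β) _)).congr' ?_ (by simp)
  filter_upwards [self_mem_nhdsWithin] with ρ hρ
  rw [← Real.rpow_add hρ]
  simp

lemma isLittleO_tsum_min_mul {ι : Type*} [Fintype ι] {s : ℝ}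
    (hs : (Fintype.card ι : ℝ) / 2 < s) (hs1 : s < (Fintype.card ι : ℝ) / 2 + 1)
    {a : (ι → ℤ) → ℝ} (ha : ∀ k, 0 ≤ a k) (hsum : Summable fun k => ‖k‖ ^ (2 * s) * a k ^ 2) :
    (fun ρ : ℝ => ∑' k, min 1 (ρ * ‖k‖) * a k)
      =o[𝓝[>] 0] fun ρ => ρ ^ (s - Fintype.card ι / 2) := by
  obtain ⟨C, hC⟩ := exists_tsum_min_mul_le hs hs1
  have htail_lim : Tendsto (fun T : Finset (ι → ℤ) =>
      C * √(∑' k : ↥(T : Set (ι → ℤ))ᶜ, ‖(k : ι → ℤ)‖ ^ (2 * s) * a k ^ 2)) atTop (𝓝 0) := by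
    simpa using! ((tendsto_tsum_compl_atTop_zero
      fun k : ι → ℤ => ‖k‖ ^ (2 * s) * a k ^ 2).sqrt).const_mul C
  rw [Asymptotics.isLittleO_iff]
  intro η hη
  obtain ⟨T, hT⟩ := (htail_lim.eventually (gt_mem_nhds (half_pos hη))).exists
  have hhead : (fun ρ : ℝ => ρ * ∑ k ∈ T, ‖k‖ * a k)
      =o[𝓝[>] 0] fun ρ => ρ ^ (s - Fintype.card ι / 2) := by
    simpa using (isLittleO_id_rpow (by linarith)).mul_isBigO
      (Asymptotics.isBigO_const_const (∑ k ∈ T, ‖k‖ * a k) (one_ne_zero (α := ℝ)) _)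
  filter_upwards [self_mem_nhdsWithin, hhead.bound (half_pos hη)] with ρ hρ hρT
  have hρ : 0 < ρ := hρ
  have hsmall : ∑ k ∈ T, min 1 (ρ * ‖k‖) * a k ≤ ρ * ∑ k ∈ T, ‖k‖ * a k := by
    rw [Finset.mul_sum]
    refine Finset.sum_le_sum fun k _ => ?_
    rw [← mul_assoc]
    exact mul_le_mul_of_nonneg_right (min_le_right _ _) (ha k)
  obtain ⟨hmin, hmin_le⟩ := hC a ha hsum ρ hρ
  have htail := (hmin_le (T : Set (ι → ℤ))ᶜ).trans_eq (mul_right_comm _ _ _)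
  rw [Real.norm_of_nonneg (tsum_nonneg fun k => mul_nonneg (by positivity) (ha k)),
    Real.norm_of_nonneg (by positivity), ← hmin.sum_add_tsum_compl (s := T)]
  rw [Real.norm_of_nonneg (mul_nonneg hρ.le (Finset.sum_nonneg fun k _ =>
    mul_nonneg (norm_nonneg k) (ha k))), Real.norm_of_nonneg (by positivity)] at hρT
  have hpow : 0 ≤ ρ ^ (s - Fintype.card ι / 2) := by positivity
  nlinarith

lemma MemSobolev.mono {d : ℕ} {s t : ℝ} {w : Torus d → ℂ} (ht : 0 < t) (hts : t ≤ s)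
    (hw : MemSobolev s w) : MemSobolev t w := by
  refine ⟨hw.1, hw.2.of_nonneg_of_le (fun k => by positivity) fun k => ?_⟩
  gcongr ?_ * _
  rcases eq_or_ne k 0 with rfl | hk
  · simp [Real.zero_rpow ht.ne', Real.zero_rpow (ht.trans_le hts).ne']
  · refine Real.rpow_le_rpow_of_exponent_le ?_ hts
    nlinarith [sq_norm_le_sum_sq k, one_le_norm_of_ne_zero hk]

lemma MemSobolev.summable_norm_rpow_mul_sq {d : ℕ} {s : ℝ} {w : Torus d → ℂ} (hs : 0 ≤ s)
    (hw : MemSobolev s w) :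
    Summable fun k : Fin d → ℤ => ‖k‖ ^ (2 * s) * ‖mFourierCoeff w k‖ ^ 2 := by
  refine hw.2.of_nonneg_of_le (fun k => by positivity) fun k => ?_
  rw [Real.rpow_mul (norm_nonneg k), Real.rpow_ofNat]
  gcongr
  exact sq_norm_le_sum_sq k

lemma MemSobolev.summable_norm_mFourierCoeff {d : ℕ} {s : ℝ} {w : Torus d → ℂ}
    (hs : (d : ℝ) / 2 < s) (hs1 : s < (d : ℝ) / 2 + 1) (hw : MemSobolev s w) :
    Summable fun k => ‖mFourierCoeff w k‖ := by
  have hs0 : 0 ≤ s := le_trans (by positivity) hs.le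
  obtain ⟨C, hC⟩ := exists_tsum_min_mul_le (ι := Fin d) (s := s) (by simpa) (by simpa)
  refine (summable_congr_cofinite ?_).mp
    (hC _ (fun k => norm_nonneg _) (hw.summable_norm_rpow_mul_sq hs0) 1 one_pos).1
  filter_upwards [(Set.finite_singleton (0 : Fin d → ℤ)).compl_mem_cofinite] with k hk
  rw [one_mul, min_eq_left (one_le_norm_of_ne_zero hk), one_mul]

theorem MemSobolev.exists_continuousMap {d : ℕ} {s : ℝ} {w : Torus d → ℂ}
    (hs : (d : ℝ) / 2 < s) (hs1 : s < (d : ℝ) / 2 + 1) (hw : MemSobolev s w) :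
    ∃ F : C(Torus d, ℂ), F =ᵐ[torusMeasure d] w ∧
      ∀ x₀, (fun x => F x - F x₀) =o[𝓝 x₀] fun x => ‖x - x₀‖ ^ (s - d / 2) := by
  have hs0 : 0 ≤ s := le_trans (by positivity) hs.le
  obtain ⟨F, hFw, hF⟩ := exists_continuousMap_of_summable_mFourierCoeff hw.1
    (hw.summable_norm_mFourierCoeff hs hs1)
  refine ⟨F, hFw, fun x₀ => ?_⟩
  have hsum := hw.summable_norm_rpow_mul_sq hs0
  obtain ⟨C, hC⟩ := exists_tsum_min_mul_le (ι := Fin d) (s := s) (by simpa) (by simpa)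
  have hmodulus : (fun x => ∑' k, min 1 (‖x - x₀‖ * ‖k‖) * ‖mFourierCoeff w k‖)
      =o[𝓝[≠] x₀] fun x => ‖x - x₀‖ ^ (s - d / 2) := by
    have := isLittleO_tsum_min_mul (by simpa) (by simpa) (fun k => norm_nonneg _) hsum
    rw [Fintype.card_fin] at this
    exact this.comp_tendsto (tendsto_norm_sub_self_nhdsNE x₀)
  suffices hO : (fun x => F x - F x₀) =O[𝓝[≠] x₀] fun x =>
      ∑' k, min 1 (‖x - x₀‖ * ‖k‖) * ‖mFourierCoeff w k‖ by
    simpa [← nhdsWithin_univ] using (hO.trans_isLittleO hmodulus).insert (sub_self (F x₀))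
  refine .of_bound (2 + 2 * Real.pi * d) ?_
  filter_upwards [self_mem_nhdsWithin] with x hx
  have hmin := (hC _ (fun k => norm_nonneg _) hsum _ (norm_sub_pos_iff.mpr hx)).1
  rw [Real.norm_of_nonneg (tsum_nonneg fun k => by positivity), ← tsum_mul_left,
    ← ((hF x).sub (hF x₀)).tsum_eq]
  refine tsum_of_norm_bounded (hmin.mul_left _).hasSum fun k => ?_
  rw [← mul_sub, norm_mul, ← mul_assoc, mul_comm]
  gcongr
  simpa using norm_mFourier_sub_le_mul_min k x x₀

/-! ### Scalar multipliers -/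

/-- Multiplication by the scalar function `u` on the Fourier side, as an operator from `ℓ²(ℤᵈ)` to
`ℓ^q(ℤᵈ)` of norm at most `C`. The domain is written as `L²(𝕋ᵈ)`, which has the same norm. -/
def IsScalarMultiplierWith {d : ℕ} (q : ℝ≥0∞) (C : ℝ) (u : Torus d → ℂ) : Prop :=
  ∀ f : Torus d → ℂ, MemLp f 2 (torusMeasure d) → ∃ b : SeqSpace d q,
    (∀ n, b n = mFourierCoeff (fun x => u x * f x) n) ∧ ‖b‖ ≤ C * lpNorm f 2 (torusMeasure d)

lemma exists_invFourier_ae_eq {d : ℕ} {f : Torus d → ℂ} (hf : MemLp f 2 (torusMeasure d)) :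
    ∃ a : SeqSpace d 2, invFourier a =ᵐ[torusMeasure d] f ∧ ‖a‖ = lpNorm f 2 (torusMeasure d) := by
  refine ⟨(mFourierBasis (d := Fin d)).repr (hf.toLp f), ?_, ?_⟩
  · rw [invFourier, LinearIsometryEquiv.symm_apply_apply]
    exact hf.coeFn_toLp
  · rw [LinearIsometryEquiv.norm_map, ← toReal_eLpNorm hf.1]
    exact Lp.norm_toLp f hf

lemma lpNorm_invFourier {d : ℕ} (a : SeqSpace d 2) :
    lpNorm (invFourier a) 2 (torusMeasure d) = ‖a‖ := by
  have hmeas : AEStronglyMeasurable (invFourier a) (torusMeasure d) := Lp.aestronglyMeasurable _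
  rw [← toReal_eLpNorm hmeas, ← LinearIsometryEquiv.norm_map
    (mFourierBasis (d := Fin d)).repr.symm a]
  exact (Lp.norm_def _).symm

lemma multiplierOp_single {d K : ℕ} (U : Torus d → Matrix (Fin K) (Fin K) ℂ) (i j : Fin K)
    (a : SeqSpace d 2) (n : Fin d → ℤ) :
    multiplierOp U (PiLp.single 2 j a) i n
      = mFourierCoeff (fun x => U x i j * invFourier a x) n := by
  refine mFourierCoeff_congr_ae ?_ n
  have hzero : invFourier (0 : SeqSpace d 2) =ᵐ[torusMeasure d] 0 := by
    rw [invFourier, map_zero]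
    exact Lp.coeFn_zero _ _ _
  filter_upwards [hzero] with x hx
  rw [Matrix.mulVec, dotProduct, Finset.sum_eq_single j]
  · rw [PiLp.single_eq_same]
  · intro l _ hl
    rw [PiLp.single_eq_of_ne 2 hl, hx, Pi.zero_apply, mul_zero]
  · exact fun hj => absurd (Finset.mem_univ j) hj

lemma IsMatrixMultiplier.exists_isScalarMultiplierWith {d K : ℕ} {q : ℝ≥0∞} (hq : 1 ≤ q)
    {U : Torus d → Matrix (Fin K) (Fin K) ℂ} (hU : IsMatrixMultiplier q U) :
    ∃ C, 0 ≤ C ∧ ∀ i j, IsScalarMultiplierWith q C fun x => U x i j := by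
  have : Fact (1 ≤ q) := ⟨hq⟩
  obtain ⟨-, C, hC⟩ := hU
  refine ⟨max C 0, le_max_right _ _, fun i j f hf => ?_⟩
  obtain ⟨a, ha, hanorm⟩ := exists_invFourier_ae_eq hf
  obtain ⟨B, hB, hBnorm⟩ := hC (PiLp.single 2 j a)
  refine ⟨B i, fun n => ?_, ?_⟩
  · rw [hB, multiplierOp_single]
    exact mFourierCoeff_congr_ae (ha.mono fun x hx => by simp only [hx]) n
  · calc ‖B i‖ ≤ ‖B‖ := PiLp.norm_apply_le B i
      _ ≤ C * lpNorm f 2 (torusMeasure d) := by rwa [PiLp.norm_single, hanorm] at hBnorm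
      _ ≤ max C 0 * lpNorm f 2 (torusMeasure d) := by
        gcongr
        exacts [lpNorm_nonneg, le_max_left _ _]

lemma IsScalarMultiplierWith.isMatrixMultiplier_smul_one {d : ℕ} {q : ℝ≥0∞} (hq : 1 ≤ q) {C : ℝ}
    (hC : 0 ≤ C) {u : Torus d → ℂ} (hu : IsScalarMultiplierWith q C u)
    (hu2 : MemLp u 2 (torusMeasure d)) (K : ℕ) :
    IsMatrixMultiplier q fun x => u x • (1 : Matrix (Fin K) (Fin K) ℂ) := by
  have : Fact (1 ≤ q) := ⟨hq⟩
  refine ⟨fun i j => ?_, K * C, fun A => ?_⟩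
  · simpa only [Matrix.smul_apply, smul_eq_mul] using hu2.mul_const _
  choose b hb hbnorm using fun i => hu (invFourier (A i)) (Lp.memLp _)
  refine ⟨WithLp.toLp q b, fun i n => ?_, ?_⟩
  · simpa only [multiplierOp, Matrix.smul_mulVec, Matrix.one_mulVec, Pi.smul_apply, smul_eq_mul]
      using hb i n
  have hsum : WithLp.toLp q b = ∑ i, PiLp.single q i (b i) := by
    ext j : 1
    simp
  calc ‖WithLp.toLp q b‖ ≤ ∑ i, ‖b i‖ := by
        rw [hsum]
        exact (norm_sum_le _ _).trans (by simp only [PiLp.norm_single, le_refl])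
    _ ≤ ∑ _i : Fin K, C * ‖A‖ := by
        gcongr with i
        exact (hbnorm i).trans (by rw [lpNorm_invFourier]; gcongr; exact PiLp.norm_apply_le A i)
    _ = K * C * ‖A‖ := by simp [mul_assoc]

/-! ### Lower bounds for multipliers -/

lemma integrable_mFourier_smul {d : ℕ} {f : Torus d → ℂ} (hf : Integrable f (torusMeasure d))
    (n : Fin d → ℤ) : Integrable (fun x => mFourier (-n) x • f x) (torusMeasure d) :=
  hf.bdd_mul (c := 1) (by fun_prop) (ae_of_all _ fun x => (norm_mFourier_apply _ x).le)

lemma mFourierCoeff_finset_sum {d : ℕ} {ι : Type*} (s : Finset ι) {f : ι → Torus d → ℂ}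
    (hf : ∀ i ∈ s, Integrable (f i) (torusMeasure d)) (n : Fin d → ℤ) :
    mFourierCoeff (fun x => ∑ i ∈ s, f i x) n = ∑ i ∈ s, mFourierCoeff (f i) n := by
  simp only [mFourierCoeff_eq, Finset.smul_sum]
  exact integral_finsetSum s fun i hi => integrable_mFourier_smul (hf i hi) n

lemma haarAddCircle_eq_volume : (AddCircle.haarAddCircle : Measure UnitAddCircle) = volume := by
  rw [AddCircle.volume_eq_smul_haarAddCircle, ENNReal.ofReal_one, one_smul]

lemma torusMeasure_real_closedBall {d : ℕ} (x : Torus d) {r : ℝ} (h0 : 0 ≤ r) (h1 : r ≤ 1 / 2) :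
    (torusMeasure d).real (Metric.closedBall x r) = (2 * r) ^ d := by
  rw [measureReal_def, closedBall_pi _ h0, torusMeasure, Measure.pi_pi]
  simp only [haarAddCircle_eq_volume, AddCircle.volume_closedBall]
  rw [min_eq_right (by linarith), Finset.prod_const, Finset.card_univ, Fintype.card_fin,
    ENNReal.toReal_pow, ENNReal.toReal_ofReal (by linarith)]

lemma half_measureReal_le_norm_mFourierCoeff_indicator {d : ℕ} (x₀ : Torus d) {r : ℝ}
    (n : Fin d → ℤ) (hn : 2 * Real.pi * d * (‖n‖ * r) ≤ 1 / 2) :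
    (torusMeasure d).real (Metric.closedBall x₀ r) / 2
      ≤ ‖mFourierCoeff ((Metric.closedBall x₀ r).indicator 1 : Torus d → ℂ) n‖ := by
  set S := Metric.closedBall x₀ r
  have hS : MeasurableSet S := Metric.isClosed_closedBall.measurableSet
  have hcoeff : mFourierCoeff (S.indicator 1 : Torus d → ℂ) n
      = ∫ x in S, mFourier (-n) x ∂torusMeasure d := by
    rw [mFourierCoeff_eq, ← integral_indicator hS]
    congr 1 with x
    by_cases hx : x ∈ S <;> simp [hx]
  have hint : Integrable (mFourier (-n)) (torusMeasure d) :=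
    .of_bound (by fun_prop) 1 (ae_of_all _ fun x => (norm_mFourier_apply _ x).le)
  have hosc : ‖(∫ x in S, mFourier (-n) x ∂torusMeasure d)
      - (torusMeasure d).real S • mFourier (-n) x₀‖ ≤ 1 / 2 * (torusMeasure d).real S := by
    rw [← setIntegral_const, ← integral_sub hint.integrableOn (integrable_const _)]
    refine norm_setIntegral_le_of_norm_le_const (measure_lt_top _ _) fun x hx => ?_
    refine (norm_mFourier_sub_le _ _ _).trans (le_trans ?_ hn)
    rw [norm_neg, Fintype.card_fin]
    gcongr
    exact mem_closedBall_iff_norm.mp hx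
  have hcentre : ‖(torusMeasure d).real S • mFourier (-n) x₀‖ = (torusMeasure d).real S := by
    rw [norm_smul, norm_mFourier_apply, mul_one, Real.norm_of_nonneg measureReal_nonneg]
  have htri := norm_sub_norm_le ((torusMeasure d).real S • mFourier (-n) x₀)
    (∫ x in S, mFourier (-n) x ∂torusMeasure d)
  rw [norm_sub_rev, hcentre] at htri
  rw [hcoeff]
  linarith

lemma rpow_mul_le_norm_of_forall_le {d : ℕ} {q : ℝ≥0∞} (hq : q ≠ 0) (b : SeqSpace d q) {R c : ℝ}
    (hR : 0 ≤ R) (hc : 0 ≤ c) (h : ∀ n : Fin d → ℤ, ‖n‖ ≤ R → c ≤ ‖b n‖) :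
    R ^ (d * q⁻¹.toReal) * c ≤ ‖b‖ := by
  rcases eq_or_ne q ⊤ with rfl | hq'
  · simp only [ENNReal.inv_top, ENNReal.toReal_zero, mul_zero, Real.rpow_zero, one_mul]
    exact (h 0 (by simpa using hR)).trans (lp.norm_apply_le_norm hq b 0)
  have hqr : 0 < q.toReal := ENNReal.toReal_pos hq hq'
  have hpow : R ^ d * c ^ q.toReal ≤ ‖b‖ ^ q.toReal := by
    refine le_trans ?_ (lp.sum_rpow_le_norm_rpow hqr b
      (Fintype.piFinset fun _ : Fin d => Finset.Icc (-(⌊R⌋₊ : ℤ)) ⌊R⌋₊))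
    refine le_trans ?_ (Finset.card_nsmul_le_sum _ _ (c ^ q.toReal) fun n hn => ?_)
    · have hcard : R ≤ ((⌊R⌋₊ + 1 - -(⌊R⌋₊ : ℤ)).toNat : ℝ) := by
        rw [show (⌊R⌋₊ + 1 - -(⌊R⌋₊ : ℤ)).toNat = 2 * ⌊R⌋₊ + 1 by lia]
        push_cast
        linarith [Nat.lt_floor_add_one R, (⌊R⌋₊.cast_nonneg : (0 : ℝ) ≤ ⌊R⌋₊)]
      rw [Fintype.card_piFinset, Finset.prod_const, Int.card_Icc, Finset.card_univ,
        Fintype.card_fin, nsmul_eq_mul, Nat.cast_pow]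
      gcongr
    · gcongr
      refine h n ((pi_norm_le_iff_of_nonneg hR).mpr fun i => ?_)
      have hi := Finset.mem_Icc.mp (Fintype.mem_piFinset.mp hn i)
      rw [Int.norm_eq_abs]
      exact (by exact_mod_cast abs_le.mpr hi : |(n i : ℝ)| ≤ ⌊R⌋₊).trans (Nat.floor_le hR)
  have hroot := Real.rpow_le_rpow (by positivity) hpow (inv_nonneg.mpr hqr.le)
  rwa [Real.rpow_rpow_inv (lp.norm_nonneg' b) hqr.ne',
    Real.mul_rpow (by positivity) (by positivity), Real.rpow_rpow_inv hc hqr.ne',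
    ← Real.rpow_natCast, ← Real.rpow_mul hR, ← ENNReal.toReal_inv] at hroot

lemma rpow_mul_half_measureReal_le_norm {d : ℕ} {q : ℝ≥0∞} (hq : q ≠ 0) {x₀ : Torus d} {r : ℝ}
    (hr : 0 < r) {b : SeqSpace d q}
    (hb : ∀ n, b n = mFourierCoeff ((Metric.closedBall x₀ r).indicator 1) n) :
    (4 * Real.pi * (d + 1) * r)⁻¹ ^ (d * q⁻¹.toReal)
      * ((torusMeasure d).real (Metric.closedBall x₀ r) / 2) ≤ ‖b‖ := by
  refine rpow_mul_le_norm_of_forall_le hq b (by positivity) (by positivity) fun n hn => ?_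
  rw [hb]
  refine half_measureReal_le_norm_mFourierCoeff_indicator x₀ n ?_
  calc 2 * Real.pi * d * (‖n‖ * r)
      ≤ 2 * Real.pi * (d + 1) * ((4 * Real.pi * (d + 1) * r)⁻¹ * r) := by
        gcongr
        linarith
    _ = 1 / 2 := by
        field_simp
        norm_num

lemma memLp_and_lpNorm_le_of_norm_le_indicator {α : Type*} [MeasurableSpace α] {μ : Measure α}
    [IsFiniteMeasure μ] {f : α → ℂ} (hf : AEStronglyMeasurable f μ) {S : Set α}
    (hS : MeasurableSet S) {M : ℝ} (hM : 0 ≤ M) (h : ∀ᵐ x ∂μ, ‖f x‖ ≤ S.indicator (fun _ => M) x) :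
    MemLp f 2 μ ∧ lpNorm f 2 μ ≤ M * √(μ.real S) := by
  have hind : MemLp (S.indicator fun _ => M) 2 μ :=
    memLp_indicator_const 2 hS M (.inr (measure_ne_top μ S))
  have hle : ∀ᵐ x ∂μ, ‖f x‖ ≤ ‖S.indicator (fun _ => M) x‖ :=
    h.mono fun x hx => hx.trans (Real.le_norm_self _)
  refine ⟨hind.of_le hf hle, ?_⟩
  rw [← toReal_eLpNorm hf]
  refine (ENNReal.toReal_mono hind.2.ne (eLpNorm_mono_ae hle)).trans_eq ?_
  rw [eLpNorm_indicator_const hS two_ne_zero ENNReal.ofNat_ne_top, ENNReal.toReal_mul,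
    toReal_enorm, Real.norm_of_nonneg hM, ← ENNReal.toReal_rpow, ENNReal.toReal_ofNat,
    ← Real.sqrt_eq_rpow, measureReal_def]

section Frobenius

open scoped Matrix.Norms.Frobenius
open WithLp

lemma norm_toLp_mulVec_le {m n : Type*} [Fintype m] [Fintype n] (A : Matrix m n ℂ) (v : n → ℂ) :
    ‖toLp 2 (A *ᵥ v)‖ ≤ ‖A‖ * ‖toLp 2 v‖ := by
  simpa only [← Matrix.frobenius_norm_replicateCol (ι := Unit), Matrix.replicateCol_mulVec]
    using Matrix.frobenius_norm_mul A (Matrix.replicateCol Unit v)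

lemma one_le_mul_norm_of_mul_eq_one {n : Type*} [Fintype n] [DecidableEq n] {A U : Matrix n n ℂ}
    (hAU : A * U = 1) {v : n → ℂ} (hv : v ≠ 0) {t : ℝ}
    (h : ‖toLp 2 (A *ᵥ v)‖ ≤ t * ‖toLp 2 v‖) : 1 ≤ t * ‖U‖ := by
  have hv0 : 0 < ‖toLp 2 v‖ := norm_pos_iff.mpr (by simpa using hv)
  refine le_of_mul_le_mul_right ?_ hv0
  calc 1 * ‖toLp 2 v‖ = ‖toLp 2 (U *ᵥ (A *ᵥ v))‖ := by
        rw [Matrix.mulVec_mulVec, mul_eq_one_comm.mp hAU, Matrix.one_mulVec, one_mul]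
    _ ≤ ‖U‖ * (t * ‖toLp 2 v‖) := (norm_toLp_mulVec_le _ _).trans (by gcongr)
    _ = t * ‖U‖ * ‖toLp 2 v‖ := by ring

lemma frobenius_norm_sq {m n : Type*} [Fintype m] [Fintype n] (A : Matrix m n ℂ) :
    ‖A‖ ^ 2 = ∑ i, ∑ j, ‖A i j‖ ^ 2 := by
  rw [Matrix.frobenius_norm_def, ← Real.sqrt_eq_rpow, Real.sq_sqrt (by positivity)]
  simp only [Real.rpow_two]

lemma norm_apply_le_frobenius_norm {m n : Type*} [Fintype m] [Fintype n] (A : Matrix m n ℂ)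
    (i : m) (j : n) : ‖A i j‖ ≤ ‖A‖ := by
  refine (sq_le_sq₀ (norm_nonneg _) (norm_nonneg _)).mp ?_
  rw [frobenius_norm_sq]
  exact (Finset.single_le_sum (f := fun j => ‖A i j‖ ^ 2) (fun _ _ => by positivity)
    (Finset.mem_univ j)).trans (Finset.single_le_sum (f := fun i => ∑ j, ‖A i j‖ ^ 2)
      (fun _ _ => by positivity) (Finset.mem_univ i))

lemma norm_star_mul_inv_sq_norm_le {m n : Type*} [Fintype m] [Fintype n] {A : Matrix m n ℂ} {M : ℝ}
    (hM : 0 ≤ M) (h : 1 ≤ M * ‖A‖) (i : m) (j : n) :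
    ‖star (A i j) * ((‖A‖ ^ 2)⁻¹ : ℝ)‖ ≤ M := by
  have hpos : 0 < ‖A‖ := pos_of_mul_pos_right (zero_lt_one.trans_le h) hM
  rw [norm_mul, norm_star, Complex.norm_real, Real.norm_of_nonneg (by positivity),
    ← div_eq_mul_inv, div_le_iff₀ (by positivity)]
  calc ‖A i j‖ ≤ 1 * ‖A‖ := by rw [one_mul]; exact norm_apply_le_frobenius_norm A i j
    _ ≤ M * ‖A‖ * ‖A‖ := by gcongr
    _ = M * ‖A‖ ^ 2 := by ring

lemma sum_mul_star_mul_inv_sq_norm {m n : Type*} [Fintype m] [Fintype n] {A : Matrix m n ℂ}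
    (hA : ‖A‖ ≠ 0) : ∑ i, ∑ j, A i j * (star (A i j) * ((‖A‖ ^ 2)⁻¹ : ℝ)) = 1 := by
  have hsum : ∑ i, ∑ j, A i j * star (A i j) = ((‖A‖ ^ 2 : ℝ) : ℂ) := by
    simp only [frobenius_norm_sq, Complex.ofReal_sum, Complex.ofReal_pow]
    exact Finset.sum_congr rfl fun i _ => Finset.sum_congr rfl fun j _ => Complex.mul_conj' _
  simp only [← mul_assoc, ← Finset.sum_mul]
  rw [hsum, ← Complex.ofReal_mul, mul_inv_cancel₀ (pow_ne_zero 2 hA), Complex.ofReal_one]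

lemma exists_sum_mul_eq_indicator {α m n : Type*} [Fintype m] [Fintype n] [MeasurableSpace α]
    {μ : Measure α} [IsFiniteMeasure μ] {U : α → Matrix m n ℂ}
    (hU : ∀ i j, AEStronglyMeasurable (fun x => U x i j) μ) {S : Set α} (hS : MeasurableSet S)
    {M : ℝ} (hM : 0 ≤ M) (h : ∀ᵐ x ∂μ, x ∈ S → 1 ≤ M * ‖U x‖) :
    ∃ f : m → n → α → ℂ,
      (∀ i j, MemLp (f i j) 2 μ ∧ lpNorm (f i j) 2 μ ≤ M * √(μ.real S)) ∧
      S.indicator 1 =ᵐ[μ] fun x => ∑ i, ∑ j, U x i j * f i j x := by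
  refine ⟨fun i j => S.indicator fun x => star (U x i j) * ((‖U x‖ ^ 2)⁻¹ : ℝ),
    fun i j => memLp_and_lpNorm_le_of_norm_le_indicator ?_ hS hM ?_, ?_⟩
  · have hnorm : AEStronglyMeasurable (fun x => ‖U x‖ ^ 2) μ := by
      simp only [frobenius_norm_sq]
      fun_prop
    exact ((hU i j).star.mul (Complex.continuous_ofReal.comp_aestronglyMeasurable
      hnorm.aemeasurable.inv.aestronglyMeasurable)).indicator hS
  · filter_upwards [h] with x hx
    by_cases hxS : x ∈ S
    · simpa only [Set.indicator_of_mem hxS] using norm_star_mul_inv_sq_norm_le hM (hx hxS) i j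
    · simp only [Set.indicator_of_notMem hxS, norm_zero, le_refl]
  · filter_upwards [h] with x hx
    by_cases hxS : x ∈ S
    · have hne : ‖U x‖ ≠ 0 := right_ne_zero_of_mul (zero_lt_one.trans_le (hx hxS)).ne'
      simp only [Set.indicator_of_mem hxS, Pi.one_apply, sum_mul_star_mul_inv_sq_norm hne]
    · simp only [Set.indicator_of_notMem hxS, mul_zero, Finset.sum_const_zero]

lemma IsMatrixMultiplier.exists_mFourierCoeff_indicator {d K : ℕ} {q : ℝ≥0∞} (hq : 1 ≤ q)
    {U : Torus d → Matrix (Fin K) (Fin K) ℂ} (hU : IsMatrixMultiplier q U) :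
    ∃ C, 0 ≤ C ∧ ∀ (S : Set (Torus d)) (M : ℝ), MeasurableSet S → 0 ≤ M →
      (∀ᵐ x ∂torusMeasure d, x ∈ S → 1 ≤ M * ‖U x‖) → ∃ b : SeqSpace d q,
        (∀ n, b n = mFourierCoeff (S.indicator 1) n) ∧
        ‖b‖ ≤ C * (M * √((torusMeasure d).real S)) := by
  have : Fact (1 ≤ q) := ⟨hq⟩
  obtain ⟨C, hC0, hC⟩ := hU.exists_isScalarMultiplierWith hq
  refine ⟨K * K * C, by positivity, fun S M hS hM h => ?_⟩
  obtain ⟨f, hf, hsum⟩ := exists_sum_mul_eq_indicator (fun i j => (hU.1 i j).1) hS hM h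
  choose b hb hbnorm using fun i j => hC i j (f i j) (hf i j).1
  have hint (i j : Fin K) : Integrable (fun x => U x i j * f i j x) (torusMeasure d) :=
    (hU.1 i j).integrable_mul (hf i j).1
  refine ⟨∑ i, ∑ j, b i j, fun n => ?_, ?_⟩
  · rw [mFourierCoeff_congr_ae hsum, mFourierCoeff_finset_sum _
      fun i _ => integrable_finsetSum _ fun j _ => hint i j]
    simp only [mFourierCoeff_finset_sum _ fun j _ => hint _ j, lp.coeFn_sum, Finset.sum_apply, hb]
  · calc ‖∑ i, ∑ j, b i j‖
        ≤ ∑ _i : Fin K, ∑ _j : Fin K, C * (M * √((torusMeasure d).real S)) :=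
          norm_sum_le_of_le _ fun i _ => norm_sum_le_of_le _ fun j _ =>
            (hbnorm i j).trans (by gcongr; exact (hf i j).2)
      _ = K * K * C * (M * √((torusMeasure d).real S)) := by
          simp only [Finset.sum_const, Finset.card_univ, Fintype.card_fin, nsmul_eq_mul]
          ring

lemma IsMatrixMultiplier.exists_rpow_le_mul {d K : ℕ} {q : ℝ≥0∞} (hq : 1 ≤ q)
    {U : Torus d → Matrix (Fin K) (Fin K) ℂ} (hU : IsMatrixMultiplier q U) :
    ∃ C, 0 ≤ C ∧ ∀ (x₀ : Torus d) (r M : ℝ), 0 < r → r ≤ 1 / 2 → 0 ≤ M →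
      (∀ᵐ x ∂torusMeasure d, x ∈ Metric.closedBall x₀ r → 1 ≤ M * ‖U x‖) →
      r ^ (d / 2 - d * q⁻¹.toReal) ≤ C * M := by
  obtain ⟨C, hC0, hC⟩ := hU.exists_mFourierCoeff_indicator hq
  set e := d * q⁻¹.toReal with he
  obtain ⟨a, ha, haeq⟩ : ∃ a : ℝ, 0 < a ∧ 4 * Real.pi * (d + 1) = a := ⟨_, by positivity, rfl⟩
  refine ⟨2 * C * a ^ e, by positivity, fun x₀ r M hr hr1 hM h => ?_⟩
  obtain ⟨b, hb, hbnorm⟩ := hC _ M Metric.isClosed_closedBall.measurableSet hM h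
  have hlow := rpow_mul_half_measureReal_le_norm (zero_lt_one.trans_le hq).ne' hr hb
  rw [haeq, ← he] at hlow
  rw [torusMeasure_real_closedBall x₀ hr.le hr1] at hlow hbnorm
  set V := (2 * r) ^ d
  have hV : 0 < √V := by positivity
  have hmain : (a * r)⁻¹ ^ e * √V ≤ 2 * C * M := by
    refine le_of_mul_le_mul_right ?_ hV
    rw [mul_assoc, Real.mul_self_sqrt (by positivity)]
    linarith [hlow.trans hbnorm]
  calc r ^ (d / 2 - e) = a ^ e * ((a * r)⁻¹ ^ e * r ^ (d / 2 : ℝ)) := by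
        rw [mul_inv, Real.mul_rpow (by positivity) (by positivity), Real.inv_rpow ha.le,
          Real.inv_rpow hr.le, Real.rpow_sub hr]
        field_simp
    _ ≤ a ^ e * ((a * r)⁻¹ ^ e * √V) := by
        rw [show √V = (2 * r) ^ (d / 2 : ℝ) by
          rw [Real.sqrt_eq_rpow, ← Real.rpow_natCast_mul (by positivity), mul_one_div]]
        gcongr
        linarith
    _ ≤ a ^ e * (2 * C * M) := by gcongr
    _ = 2 * C * a ^ e * M := by ring

/-- `W x` nearly annihilates some vector for almost all `x` close to `x₀`: its smallest singular
value is `o(|x - x₀| ^ β)` as `x → x₀`. -/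
def DegeneratesAt {d K : ℕ} (β : ℝ) (W : Torus d → Matrix (Fin K) (Fin K) ℂ) (x₀ : Torus d) :
    Prop :=
  ∀ η > 0, ∀ᶠ x in 𝓝 x₀ ⊓ ae (torusMeasure d),
    ∃ v, v ≠ 0 ∧ ‖toLp 2 (W x *ᵥ v)‖ ≤ η * ‖x - x₀‖ ^ β * ‖toLp 2 v‖

theorem DegeneratesAt.not_inverseIsMultiplier {d K : ℕ} {β : ℝ} {q : ℝ≥0∞} (hβ : 0 ≤ β)
    (hq : 1 ≤ q) (hβq : d / 2 - d * q⁻¹.toReal ≤ β) {W : Torus d → Matrix (Fin K) (Fin K) ℂ}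
    {x₀ : Torus d} (hW : DegeneratesAt β W x₀) : ¬ InverseIsMultiplier q W := by
  rintro ⟨U, hWU, hU⟩
  obtain ⟨C, hC0, hC⟩ := hU.exists_rpow_le_mul hq
  obtain ⟨S, hS, T, hT, hST⟩ := mem_inf_iff_superset.mp (hW (C + 1)⁻¹ (by positivity))
  obtain ⟨ε, hε, hball⟩ := Metric.nhds_basis_closedBall.mem_iff.mp hS
  set r := min ε (1 / 2)
  have hr : 0 < r := by positivity
  have hlarge : ∀ᵐ x ∂torusMeasure d, x ∈ Metric.closedBall x₀ r →
      1 ≤ (C + 1)⁻¹ * r ^ β * ‖U x‖ := by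
    filter_upwards [hT, hWU] with x hxT hx hxr
    obtain ⟨v, hv, hWv⟩ :=
      hST ⟨hball (Metric.closedBall_subset_closedBall (min_le_left _ _) hxr), hxT⟩
    refine one_le_mul_norm_of_mul_eq_one hx hv (hWv.trans ?_)
    gcongr
    exact mem_closedBall_iff_norm.mp hxr
  have hrβ : 0 < r ^ β := by positivity
  have : r ^ β ≤ C / (C + 1) * r ^ β :=
    calc r ^ β ≤ r ^ (d / 2 - d * q⁻¹.toReal) :=
          Real.rpow_le_rpow_of_exponent_ge hr ((min_le_right _ _).trans (by norm_num)) hβq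
      _ ≤ C * ((C + 1)⁻¹ * r ^ β) := hC x₀ r _ hr (min_le_right _ _) (by positivity) hlarge
      _ = C / (C + 1) * r ^ β := by ring
  have hlt : C / (C + 1) < 1 := (div_lt_one (by positivity)).mpr (lt_add_one C)
  exact (mul_lt_of_lt_one_left hrβ hlt).not_ge this

end Frobenius

/-! ### Zeros of the determinant -/

lemma eigenvalueDesc_eq {K : ℕ} {A : Matrix (Fin K) (Fin K) ℂ} (hA : A.IsHermitian) :
    ∃ e : Fin K ≃ Fin K, ∀ k, eigenvalueDesc A k = hA.eigenvalues (e k) := by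
  refine ⟨(finCongr (Fintype.card_fin K).symm).trans (Fintype.equivOfCardEq (Fintype.card_fin _)),
    fun k => ?_⟩
  rw [eigenvalueDesc, dif_pos hA]
  simp [Matrix.IsHermitian.eigenvalues]

lemma det_eq_prod_eigenvalueDesc {K : ℕ} {A : Matrix (Fin K) (Fin K) ℂ} (hA : A.IsHermitian) :
    A.det = ∏ k, (eigenvalueDesc A k : ℂ) := by
  obtain ⟨e, he⟩ := eigenvalueDesc_eq hA
  simp only [he]
  rw [hA.det_eq_prod_eigenvalues, e.prod_comp (fun i => (hA.eigenvalues i : ℂ))]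
  rfl

lemma exists_mulVec_eq_eigenvalueDesc {K : ℕ} {A : Matrix (Fin K) (Fin K) ℂ} (hA : A.IsHermitian)
    (k : Fin K) : ∃ v : Fin K → ℂ, v ≠ 0 ∧ A *ᵥ v = (eigenvalueDesc A k : ℂ) • v := by
  obtain ⟨e, he⟩ := eigenvalueDesc_eq hA
  refine ⟨hA.eigenvectorBasis (e k), fun h0 => ?_, ?_⟩
  · exact hA.eigenvectorBasis.orthonormal.ne_zero (e k) (WithLp.ofLp_injective 2 h0)
  · rw [hA.mulVec_eigenvectorBasis, he]
    rfl

lemma HermitianWithSobolevEigenvalues.exists_degeneratesAt {d K : ℕ} {s : ℝ}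
    (hs : (d : ℝ) / 2 < s) (hs1 : s < (d : ℝ) / 2 + 1)
    {W : Torus d → Matrix (Fin K) (Fin K) ℂ} (hW : HermitianWithSobolevEigenvalues s W)
    (hdet : HasZero fun x => (W x).det) : ∃ x₀, DegeneratesAt (s - d / 2) W x₀ := by
  obtain ⟨-, hherm, hsob⟩ := hW
  obtain ⟨g, hg, hgW, x₀, hx₀⟩ := hdet
  choose F hF hFo using fun k => (hsob k).exists_continuousMap hs hs1
  have hgF : g = fun x => ∏ k, F k x := by
    refine (Continuous.ae_eq_iff_eq (torusMeasure d) hg (by fun_prop)).mp ?_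
    filter_upwards [hgW, hherm, ae_all_iff.mpr hF] with x hx hA hFx
    rw [hx, det_eq_prod_eigenvalueDesc hA]
    simp only [hFx]
  rw [hgF] at hx₀
  obtain ⟨k, -, hk⟩ := Finset.prod_eq_zero_iff.mp hx₀
  refine ⟨x₀, fun η hη => ?_⟩
  filter_upwards [((hFo k x₀).def hη).filter_mono inf_le_left,
    hherm.filter_mono inf_le_right, (hF k).filter_mono inf_le_right] with x hx hA hFx
  obtain ⟨v, hv, hAv⟩ := exists_mulVec_eq_eigenvalueDesc hA k
  refine ⟨v, hv, ?_⟩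
  rw [hk, sub_zero, hFx, Real.norm_of_nonneg (by positivity)] at hx
  rw [hAv, WithLp.toLp_smul, norm_smul]
  gcongr

lemma exists_degeneratesAt_of_memSobolev_entries {d K : ℕ} {s : ℝ}
    (hs : (d : ℝ) / 2 < s) (hs1 : s < (d : ℝ) / 2 + 1)
    {W : Torus d → Matrix (Fin K) (Fin K) ℂ} (hW : ∀ i j, MemSobolev s fun x => W x i j)
    (hdet : HasZero fun x => (W x).det) : ∃ x₀, DegeneratesAt (s - d / 2) W x₀ := by
  obtain ⟨g, hg, hgW, x₀, hx₀⟩ := hdet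
  choose F hF hFo using fun i j => (hW i j).exists_continuousMap hs hs1
  let G (x : Torus d) : Matrix (Fin K) (Fin K) ℂ := Matrix.of fun i j => F i j x
  have hGW : ∀ᵐ x ∂torusMeasure d, W x = G x := by
    filter_upwards [ae_all_iff.mpr fun i => ae_all_iff.mpr (hF i)] with x hx
    ext i j
    exact (hx i j).symm
  have hgG : g = fun x => (G x).det := by
    refine (Continuous.ae_eq_iff_eq (torusMeasure d) hg ?_).mp ?_
    · exact (continuous_matrix fun i j => (F i j).continuous).matrix_det
    · filter_upwards [hgW, hGW] with x hx hGx
      rw [hx, hGx]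
  rw [hgG] at hx₀
  obtain ⟨v, hv, hGv⟩ := Matrix.exists_mulVec_eq_zero_iff.mpr hx₀
  have ho : (fun x => WithLp.toLp 2 (G x *ᵥ v)) =o[𝓝 x₀] fun x => ‖x - x₀‖ ^ (s - d / 2) := by
    refine ((PiLp.continuousLinearEquiv 2 ℂ fun _ : Fin K => ℂ).symm.isBigO_comp
      (fun x => G x *ᵥ v) (𝓝 x₀)).trans_isLittleO (Asymptotics.isLittleO_pi.mpr fun i => ?_)
    have hrow (x : Torus d) : (G x *ᵥ v) i = ∑ j, v j * (F i j x - F i j x₀) := by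
      have h0 : (G x *ᵥ v) i = ((G x - G x₀) *ᵥ v) i := by rw [Matrix.sub_mulVec, hGv, sub_zero]
      rw [h0, Matrix.mulVec, dotProduct]
      exact Finset.sum_congr rfl fun j _ => mul_comm _ _
    simp only [hrow]
    exact Asymptotics.IsLittleO.fun_sum fun j _ => (hFo i j x₀).const_mul_left _
  have hv0 : 0 < ‖WithLp.toLp 2 v‖ := norm_pos_iff.mpr (by simpa using hv)
  refine ⟨x₀, fun η hη => ?_⟩
  filter_upwards [(ho.def (mul_pos hη hv0)).filter_mono inf_le_left,
    hGW.filter_mono inf_le_right] with x hx hGx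
  refine ⟨v, hv, ?_⟩
  rw [Real.norm_of_nonneg (by positivity)] at hx
  rw [hGx]
  linarith

/-! ### Functions in `L^p` as multipliers -/

lemma exists_coe_eq_norm_le_rpow_mul_rpow {ι : Type*} {E : ι → Type*}
    [∀ i, NormedAddCommGroup (E i)] {q : ℝ≥0∞} (hq : 2 ≤ q) (a : lp E 2) {B : ℝ} (hB0 : 0 ≤ B)
    (hB : ∀ i, ‖a i‖ ≤ B) :
    ∃ b : lp E q, (∀ i, b i = a i) ∧
      ‖b‖ ≤ ‖a‖ ^ (2 * q⁻¹.toReal) * B ^ (1 - 2 * q⁻¹.toReal) := by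
  refine ⟨⟨a, (lp.memℓp a).of_exponent_ge hq⟩, fun i => rfl, ?_⟩
  rcases eq_or_ne q ⊤ with rfl | hqt
  · simpa using lp.norm_le_of_forall_le hB0 hB
  have hQ : 2 ≤ q.toReal := by simpa using ENNReal.toReal_mono hqt hq
  have hsq : HasSum (fun i => ‖a i‖ ^ 2) (‖a‖ ^ 2) := by
    simpa using lp.hasSum_norm (p := 2) (by norm_num) a
  have hterm (i : ι) : ‖a i‖ ^ q.toReal ≤ ‖a i‖ ^ 2 * B ^ (q.toReal - 2) :=
    calc ‖a i‖ ^ q.toReal = ‖a i‖ ^ 2 * ‖a i‖ ^ (q.toReal - 2) := by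
          rw [← Real.rpow_natCast, ← Real.rpow_add_of_nonneg (norm_nonneg _) (by positivity)
            (by linarith), Nat.cast_ofNat, add_sub_cancel]
      _ ≤ ‖a i‖ ^ 2 * B ^ (q.toReal - 2) := by gcongr; exact hB i
  refine lp.norm_le_of_tsum_le (by linarith) (by positivity) ?_
  calc ∑' i, ‖a i‖ ^ q.toReal ≤ ‖a‖ ^ 2 * B ^ (q.toReal - 2) :=
        hasSum_le hterm (((lp.memℓp a).of_exponent_ge hq).summable (by linarith)).hasSum
          (hsq.mul_right _)
    _ = (‖a‖ ^ (2 * q⁻¹.toReal) * B ^ (1 - 2 * q⁻¹.toReal)) ^ q.toReal := by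
        rw [Real.mul_rpow (by positivity) (by positivity), ← Real.rpow_mul (lp.norm_nonneg' a),
          ← Real.rpow_mul hB0, ENNReal.toReal_inv, ← Real.rpow_natCast]
        congr 2 <;> field_simp
        norm_num

lemma norm_mFourierCoeff_mul_le {d : ℕ} {f g : Torus d → ℂ} (hf : MemLp f 2 (torusMeasure d))
    (hg : MemLp g 2 (torusMeasure d)) (n : Fin d → ℤ) :
    ‖mFourierCoeff (fun x => f x * g x) n‖
      ≤ lpNorm f 2 (torusMeasure d) * lpNorm g 2 (torusMeasure d) := by
  calc ‖mFourierCoeff (fun x => f x * g x) n‖ ≤ ∫ x, ‖f x‖ * ‖g x‖ ∂torusMeasure d := by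
        rw [mFourierCoeff_eq]
        refine (norm_integral_le_integral_norm _).trans_eq (integral_congr_ae (ae_of_all _ ?_))
        exact fun x => by simp only [norm_smul, norm_mFourier_apply, one_mul, norm_mul]
    _ ≤ lpNorm f 2 (torusMeasure d) * lpNorm g 2 (torusMeasure d) := by
        rw [lpNorm_eq_integral_norm_rpow_toReal (by norm_num) (by norm_num) hf.1,
          lpNorm_eq_integral_norm_rpow_toReal (by norm_num) (by norm_num) hg.1]
        simpa only [one_div, ENNReal.toReal_ofNat] using integral_mul_norm_le_Lp_mul_Lq
          Real.HolderConjugate.two_two (by simpa using hf) (by simpa using hg)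

lemma memLp_mul_and_lpNorm_mul_le {α 𝕜 : Type*} [MeasurableSpace α] [RCLike 𝕜] {μ : Measure α}
    {p : ℝ≥0∞} {f g : α → 𝕜} {A : ℝ} (hf : AEStronglyMeasurable f μ) (hg : MemLp g p μ)
    (hA0 : 0 ≤ A) (hA : ∀ x, ‖f x‖ ≤ A) :
    MemLp (fun x => f x * g x) p μ ∧ lpNorm (fun x => f x * g x) p μ ≤ A * lpNorm g p μ := by
  have hle (x : α) : ‖f x * g x‖ ≤ A * ‖g x‖ := by
    rw [norm_mul]
    gcongr
    exact hA x
  refine ⟨hg.of_le_mul (hf.mul hg.1) (ae_of_all _ hle), ?_⟩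
  calc lpNorm (fun x => f x * g x) p μ ≤ lpNorm (A • fun x => ‖g x‖) p μ :=
        lpNorm_mono_real (hg.norm.const_mul A) hle
    _ = ‖A‖ * lpNorm g p μ := by rw [lpNorm_const_smul, lpNorm_norm hg.1, coe_nnnorm]
    _ = A * lpNorm g p μ := by rw [Real.norm_of_nonneg hA0]

lemma two_mul_toReal_inv_le_one {q : ℝ≥0∞} (hq : 2 ≤ q) : 2 * q⁻¹.toReal ≤ 1 := by
  have h := ENNReal.toReal_mono (by simp) (ENNReal.inv_le_inv.mpr hq)
  rw [ENNReal.toReal_inv 2, ENNReal.toReal_ofNat] at h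
  linarith

lemma isScalarMultiplierWith_of_norm_le {d : ℕ} {q : ℝ≥0∞} (hq : 2 ≤ q) {u : Torus d → ℂ}
    (hu : MemLp u 2 (torusMeasure d)) {A : ℝ} (hA : ∀ x, ‖u x‖ ≤ A) :
    IsScalarMultiplierWith q
      (A ^ (2 * q⁻¹.toReal) * lpNorm u 2 (torusMeasure d) ^ (1 - 2 * q⁻¹.toReal)) u := by
  intro f hf
  have hA0 : 0 ≤ A := (norm_nonneg _).trans (hA 0)
  have hq1 := two_mul_toReal_inv_le_one hq
  obtain ⟨huf, hnorm⟩ := memLp_mul_and_lpNorm_mul_le hu.1 hf hA0 hA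
  obtain ⟨a, ha, hanorm⟩ := exists_invFourier_ae_eq huf
  have hcoeff (n : Fin d → ℤ) : a n = mFourierCoeff (fun x => u x * f x) n := by
    rw [← mFourierCoeff_congr_ae ha, mFourierCoeff_invFourier]
  obtain ⟨b, hb, hbnorm⟩ := exists_coe_eq_norm_le_rpow_mul_rpow hq a
    (mul_nonneg lpNorm_nonneg lpNorm_nonneg) fun n =>
      (congrArg norm (hcoeff n)).trans_le (norm_mFourierCoeff_mul_le hu hf n)
  refine ⟨b, fun n => (hb n).trans (hcoeff n), hbnorm.trans ?_⟩
  set M := lpNorm f 2 (torusMeasure d)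
  have hM0 : 0 ≤ M := lpNorm_nonneg
  calc ‖a‖ ^ (2 * q⁻¹.toReal)
        * (lpNorm u 2 (torusMeasure d) * M) ^ (1 - 2 * q⁻¹.toReal)
      ≤ (A * M) ^ (2 * q⁻¹.toReal)
        * (lpNorm u 2 (torusMeasure d) * M) ^ (1 - 2 * q⁻¹.toReal) := by
        rw [hanorm]
        gcongr
        exacts [Real.rpow_nonneg (mul_nonneg lpNorm_nonneg hM0) _, lpNorm_nonneg]
    _ = A ^ (2 * q⁻¹.toReal) * lpNorm u 2 (torusMeasure d) ^ (1 - 2 * q⁻¹.toReal)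
        * (M ^ (2 * q⁻¹.toReal) * M ^ (1 - 2 * q⁻¹.toReal)) := by
        rw [Real.mul_rpow hA0 hM0, Real.mul_rpow lpNorm_nonneg hM0]
        ring
    _ = A ^ (2 * q⁻¹.toReal) * lpNorm u 2 (torusMeasure d) ^ (1 - 2 * q⁻¹.toReal) * M := by
        rw [← Real.rpow_add_of_nonneg hM0 (by positivity) (by linarith), add_sub_cancel,
          Real.rpow_one]

lemma isScalarMultiplierWith_tsum_of_fiberwise {d : ℕ} {q : ℝ≥0∞} (hq : 1 ≤ q)
    {u : Torus d → ℂ} (hu : MemLp u 2 (torusMeasure d)) {m : Torus d → ℕ} (hm : Measurable m)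
    {C : ℕ → ℝ} (hC : Summable C)
    (h : ∀ j, IsScalarMultiplierWith q (C j) ((m ⁻¹' {j}).indicator u)) :
    IsScalarMultiplierWith q (∑' j, C j) u := by
  have : Fact (1 ≤ q) := ⟨hq⟩
  intro f hf
  choose b hb hbnorm using fun j => h j f hf
  have hbound : HasSum (fun j => C j * lpNorm f 2 (torusMeasure d))
      ((∑' j, C j) * lpNorm f 2 (torusMeasure d)) := hC.hasSum.mul_right _
  have hsum : Summable b := .of_norm_bounded hbound.summable hbnorm
  refine ⟨∑' j, b j, fun n => ?_, tsum_of_norm_bounded hbound hbnorm⟩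
  have hcoeff := (lp.evalCLM ℂ (fun _ : Fin d → ℤ => ℂ) q n).hasSum hsum.hasSum
  have hint := integrable_mFourier_smul (hu.integrable_mul hf) n
  have hsplit := hasSum_integral_iUnion (fun j => hm (measurableSet_singleton j))
    (pairwise_disjoint_fiber m) hint.integrableOn
  rw [← Set.preimage_iUnion, Set.iUnion_of_singleton, Set.preimage_univ, setIntegral_univ] at hsplit
  refine hcoeff.unique (hsplit.congr_fun fun j => ?_)
  change b j n = _
  rw [hb, mFourierCoeff_eq, ← integral_indicator (hm (measurableSet_singleton j))]
  congr 1 with x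
  by_cases hx : x ∈ m ⁻¹' {j} <;> simp [hx]

lemma IsScalarMultiplierWith.mono {d : ℕ} {q : ℝ≥0∞} {C C' : ℝ} {u : Torus d → ℂ}
    (hu : IsScalarMultiplierWith q C u) (hC : C ≤ C') : IsScalarMultiplierWith q C' u := by
  intro f hf
  obtain ⟨b, hb, hbnorm⟩ := hu f hf
  exact ⟨b, hb, hbnorm.trans (mul_le_mul_of_nonneg_right hC lpNorm_nonneg)⟩

lemma IsScalarMultiplierWith.congr_ae {d : ℕ} {q : ℝ≥0∞} {C : ℝ} {u v : Torus d → ℂ}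
    (hu : IsScalarMultiplierWith q C u) (huv : u =ᵐ[torusMeasure d] v) :
    IsScalarMultiplierWith q C v := by
  intro f hf
  obtain ⟨b, hb, hbnorm⟩ := hu f hf
  refine ⟨b, fun n => (hb n).trans (mFourierCoeff_congr_ae ?_ n), hbnorm⟩
  exact huv.mono fun x hx => by simp only [hx]

lemma two_pow_log_floor_le {t : ℝ} (ht : 1 ≤ t) : (2 : ℝ) ^ Nat.log 2 ⌊t⌋₊ ≤ t := by
  have h : 2 ^ Nat.log 2 ⌊t⌋₊ ≤ ⌊t⌋₊ := Nat.pow_log_le_self 2 (Nat.floor_pos.mpr ht).ne'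
  exact (mod_cast h : (2 : ℝ) ^ Nat.log 2 ⌊t⌋₊ ≤ ⌊t⌋₊).trans (Nat.floor_le (by linarith))

lemma lt_two_pow_log_floor_add_one (t : ℝ) : t < (2 : ℝ) ^ (Nat.log 2 ⌊t⌋₊ + 1) := by
  have h : ⌊t⌋₊ + 1 ≤ 2 ^ (Nat.log 2 ⌊t⌋₊ + 1) := Nat.lt_pow_succ_log_self one_lt_two _
  exact (Nat.lt_floor_add_one t).trans_le (mod_cast h)

lemma lpNorm_indicator_le_sqrt_mul_rpow {α E : Type*} [MeasurableSpace α] [NormedAddCommGroup E]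
    {μ : Measure α} {f : α → E} {g : α → ℝ} {p c : ℝ} (hp : 2 ≤ p) (hc : 0 < c)
    (hf : AEStronglyMeasurable f μ) (hg : Integrable (fun x => g x ^ p) μ)
    (hg0 : ∀ x, 0 ≤ g x) (hfg : ∀ x, ‖f x‖ ≤ g x) {S : Set α} (hS : MeasurableSet S)
    (hcg : ∀ x ∈ S, c ≤ g x) :
    lpNorm (S.indicator f) 2 μ ≤ √(∫ x, g x ^ p ∂μ) * c ^ (1 - p / 2) := by
  have hle (x : α) : ‖S.indicator f x‖ ^ 2 ≤ g x ^ p * c ^ (2 - p) := by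
    by_cases hx : x ∈ S
    · have hgx : 0 < g x := hc.trans_le (hcg x hx)
      rw [Set.indicator_of_mem hx]
      calc ‖f x‖ ^ 2 ≤ g x ^ 2 := by gcongr; exact hfg x
        _ = g x ^ p * g x ^ (2 - p) := by
          rw [← Real.rpow_add hgx, add_sub_cancel, Real.rpow_two]
        _ ≤ g x ^ p * c ^ (2 - p) := by
          gcongr ?_ * ?_
          exact Real.rpow_le_rpow_of_nonpos hc (hcg x hx) (by linarith)
    · rw [Set.indicator_of_notMem hx, norm_zero, zero_pow two_ne_zero]
      exact mul_nonneg (Real.rpow_nonneg (hg0 x) p) (Real.rpow_nonneg hc.le _)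
  calc lpNorm (S.indicator f) 2 μ = √(∫ x, ‖S.indicator f x‖ ^ 2 ∂μ) := by
        rw [lpNorm_eq_integral_norm_rpow_toReal two_ne_zero (by norm_num) (hf.indicator hS),
          Real.sqrt_eq_rpow]
        simp
    _ ≤ √(∫ x, g x ^ p * c ^ (2 - p) ∂μ) :=
        Real.sqrt_le_sqrt (integral_mono_of_nonneg (ae_of_all _ fun x => by positivity)
          (hg.mul_const _) (ae_of_all _ hle))
    _ = √(∫ x, g x ^ p ∂μ) * c ^ (1 - p / 2) := by
        rw [integral_mul_const, Real.sqrt_mul' _ (by positivity), Real.sqrt_eq_rpow (c ^ _),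
          ← Real.rpow_mul hc.le]
        congr 2
        ring

lemma isScalarMultiplierWith_indicator {d : ℕ} {p c : ℝ} {q : ℝ≥0∞} (hq : 2 ≤ q) (hp : 2 ≤ p)
    (hc : 0 < c) {u : Torus d → ℂ} (hu : MemLp u 2 (torusMeasure d))
    (hup : Integrable (fun x => (1 + ‖u x‖) ^ p) (torusMeasure d)) {S : Set (Torus d)}
    (hS : MeasurableSet S) (hcS : ∀ x ∈ S, c ≤ 1 + ‖u x‖ ∧ 1 + ‖u x‖ ≤ 2 * c) :
    IsScalarMultiplierWith q
      (2 ^ (2 * q⁻¹.toReal) * √(∫ x, (1 + ‖u x‖) ^ p ∂torusMeasure d) ^ (1 - 2 * q⁻¹.toReal)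
        * c ^ (2 * q⁻¹.toReal + (1 - p / 2) * (1 - 2 * q⁻¹.toReal)))
      (S.indicator u) := by
  have hbdd (x : Torus d) : ‖S.indicator u x‖ ≤ 2 * c := by
    by_cases hx : x ∈ S
    · rw [Set.indicator_of_mem hx]
      linarith [(hcS x hx).2]
    · rw [Set.indicator_of_notMem hx, norm_zero]
      positivity
  have hnorm := lpNorm_indicator_le_sqrt_mul_rpow hp hc hu.1 hup (fun x => by positivity)
    (fun x => by linarith) hS fun x hx => (hcS x hx).1
  have hq1 := two_mul_toReal_inv_le_one hq
  refine (isScalarMultiplierWith_of_norm_le hq (hu.indicator hS) hbdd).mono ?_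
  set R := √(∫ x, (1 + ‖u x‖) ^ p ∂torusMeasure d)
  set θ := q⁻¹.toReal
  calc (2 * c) ^ (2 * θ) * lpNorm (S.indicator u) 2 (torusMeasure d) ^ (1 - 2 * θ)
      ≤ (2 * c) ^ (2 * θ) * (R * c ^ (1 - p / 2)) ^ (1 - 2 * θ) := by
        gcongr
        exact lpNorm_nonneg
    _ = 2 ^ (2 * θ) * R ^ (1 - 2 * θ) * c ^ (2 * θ + (1 - p / 2) * (1 - 2 * θ)) := by
        rw [Real.mul_rpow zero_le_two hc.le, Real.mul_rpow (Real.sqrt_nonneg _) (by positivity),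
          ← Real.rpow_mul hc.le, Real.rpow_add hc]
        ring

theorem exists_isScalarMultiplierWith_of_memLp {d : ℕ} {p : ℝ} {q : ℝ≥0∞} (hq : 2 ≤ q)
    (hp : 0 < p) (hpq : p⁻¹ < 1 / 2 - q⁻¹.toReal) {u : Torus d → ℂ}
    (hu : MemLp u (ENNReal.ofReal p) (torusMeasure d)) :
    ∃ C, 0 ≤ C ∧ IsScalarMultiplierWith q C u := by
  wlog hum : Measurable u generalizing u
  · obtain ⟨v, hv, huv⟩ := hu.1.aemeasurable
    obtain ⟨C, hC0, hC⟩ := this ((memLp_congr_ae huv).mp hu) hv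
    exact ⟨C, hC0, hC.congr_ae huv.symm⟩
  set θ := q⁻¹.toReal
  have hθ0 : 0 ≤ θ := ENNReal.toReal_nonneg
  have hθp : 1 < p * (1 / 2 - θ) := by rwa [inv_lt_iff_one_lt_mul₀' hp] at hpq
  have hp2 : 2 < p := by nlinarith
  have hu2 : MemLp u 2 (torusMeasure d) :=
    hu.mono_exponent (by simpa using ENNReal.ofReal_le_ofReal hp2.le)
  have hg : Integrable (fun x => (1 + ‖u x‖) ^ p) (torusMeasure d) := by
    have h := ((memLp_const (1 : ℝ)).add hu.norm).integrable_norm_rpow (by simpa using hp)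
      ENNReal.ofReal_ne_top
    refine h.congr (ae_of_all _ fun x => ?_)
    simp only [Pi.add_apply, ENNReal.toReal_ofReal hp.le]
    rw [Real.norm_of_nonneg (by positivity)]
  let m (x : Torus d) : ℕ := Nat.log 2 ⌊1 + ‖u x‖⌋₊
  have hm : Measurable m :=
    (measurable_of_countable (Nat.log 2)).comp (hum.norm.const_add 1).nat_floor
  have hone (x : Torus d) : 1 ≤ 1 + ‖u x‖ := le_add_of_nonneg_right (norm_nonneg _)
  have hpiece (j : ℕ) := isScalarMultiplierWith_indicator hq hp2.le (c := 2 ^ j) (by positivity)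
    hu2 hg (hm (measurableSet_singleton j)) (by
      rintro x rfl
      rw [← pow_succ']
      exact ⟨two_pow_log_floor_le (hone x), (lt_two_pow_log_floor_add_one _).le⟩)
  refine ⟨_, tsum_nonneg fun j => ?_, isScalarMultiplierWith_tsum_of_fiberwise
    (le_trans (by norm_num) hq) hu2 hm ?_ hpiece⟩
  · positivity
  · refine Summable.mul_left _ ?_
    simp only [← Real.rpow_pow_comm zero_le_two]
    refine summable_geometric_of_lt_one (by positivity) ?_
    exact Real.rpow_lt_one_of_one_lt_of_neg one_lt_two (by linarith)

/-! ### A Sobolev function with a zero of order `α` -/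

lemma sum_sq_le_card_mul_sq_norm {ι : Type*} [Fintype ι] (k : ι → ℤ) :
    ∑ i, (k i : ℝ) ^ 2 ≤ Fintype.card ι * ‖k‖ ^ 2 := by
  refine (Finset.sum_le_card_nsmul _ _ (‖k‖ ^ 2) fun i _ => ?_).trans (by simp)
  rw [← sq_abs, ← Int.norm_eq_abs]
  gcongr
  exact norm_le_pi_norm k i

lemma memSobolev_of_norm_mFourierCoeff_le {d : ℕ} {s t C : ℝ} {w : Torus d → ℂ} (hs : 0 < s)
    (hst : s + d / 2 < t) (hw : MemLp w 2 (torusMeasure d))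
    (hdecay : ∀ k ≠ 0, ‖mFourierCoeff w k‖ ≤ C * ‖k‖ ^ (-t)) : MemSobolev s w := by
  have hsum : Summable fun k : Fin d → ℤ => d ^ s * C ^ 2 * ‖k‖ ^ (-(2 * t - 2 * s)) :=
    (summable_norm_rpow_neg (by rw [Fintype.card_fin]; linarith)).mul_left _
  refine ⟨hw, hsum.of_nonneg_of_le (fun k => by positivity) fun k => ?_⟩
  rcases eq_or_ne k 0 with rfl | hk
  · simp only [Pi.zero_apply, Int.cast_zero, zero_pow two_ne_zero, Finset.sum_const_zero,
      Real.zero_rpow hs.ne', zero_mul]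
    positivity
  · have hk0 : 0 < ‖k‖ := norm_pos_iff.mpr hk
    calc (∑ i, (k i : ℝ) ^ 2) ^ s * ‖mFourierCoeff w k‖ ^ 2
        ≤ (d * ‖k‖ ^ 2) ^ s * (C * ‖k‖ ^ (-t)) ^ 2 := by
          gcongr
          · simpa using sum_sq_le_card_mul_sq_norm k
          · exact hdecay k hk
      _ = d ^ s * C ^ 2 * (‖k‖ ^ (2 * s) * ‖k‖ ^ (-t * 2)) := by
          rw [Real.mul_rpow (by positivity) (by positivity), mul_pow, ← Real.rpow_natCast ‖k‖,
            ← Real.rpow_mul hk0.le, Real.rpow_mul hk0.le (-t) 2, Real.rpow_two]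
          push_cast
          ring
      _ = d ^ s * C ^ 2 * ‖k‖ ^ (-(2 * t - 2 * s)) := by
          rw [← Real.rpow_add hk0]
          ring_nf

lemma hasSum_mul_re_mFourier {ι : Type*} [Fintype ι] {c : (ι → ℤ) → ℂ} {x : UnitAddTorus ι} {z : ℂ}
    (hc : ∀ k, c (-k) = c k) (h : HasSum (fun k => c k * mFourier k x) z) :
    HasSum (fun k => c k * ((mFourier k x).re : ℂ)) z := by
  have hneg : HasSum (fun k => c k * mFourier (-k) x) z := by
    simpa only [Function.comp_def, Equiv.neg_apply, hc] using (Equiv.neg _).hasSum_iff.mpr h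
  have hmean := (h.add hneg).div_const 2
  rw [add_self_div_two] at hmean
  refine hmean.congr_fun fun k => ?_
  rw [mFourier_neg, Complex.re_eq_add_conj]
  ring

/-- The function `∑ₖ |k|_∞^{-(d+α)} (1 - cos 2π⟨k, x⟩)` on `𝕋ᵈ`. It vanishes at `0`, where for
`0 < α < 2` it is comparable to `‖x‖ ^ α`. -/
def cusp (d : ℕ) (α : ℝ) (x : Torus d) : ℝ :=
  ∑' k : Fin d → ℤ, ‖k‖ ^ (-(d + α)) * (1 - (mFourier k x).re)

lemma re_mFourier_le_one {ι : Type*} [Fintype ι] (k : ι → ℤ) (x : UnitAddTorus ι) :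
    (mFourier k x).re ≤ 1 :=
  (Complex.re_le_norm _).trans_eq (norm_mFourier_apply k x)

lemma cusp_nonneg (d : ℕ) (α : ℝ) (x : Torus d) : 0 ≤ cusp d α x :=
  tsum_nonneg fun k => mul_nonneg (by positivity) (sub_nonneg.mpr (re_mFourier_le_one k x))

lemma cusp_zero (d : ℕ) (α : ℝ) : cusp d α 0 = 0 := by
  simp [cusp, mFourier]

lemma hasSum_cusp {d : ℕ} {α : ℝ} (hα : 0 < α) (x : Torus d) :
    HasSum (fun k : Fin d → ℤ => ‖k‖ ^ (-(d + α)) * (1 - (mFourier k x).re)) (cusp d α x) := by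
  have hsum : Summable fun k : Fin d → ℤ => ‖k‖ ^ (-(d + α)) * 2 :=
    (summable_norm_rpow_neg (by simpa using hα)).mul_right 2
  refine (hsum.of_nonneg_of_le (fun k => ?_) fun k => ?_).hasSum
  · exact mul_nonneg (by positivity) (sub_nonneg.mpr (re_mFourier_le_one k x))
  · gcongr
    linarith [neg_le_of_abs_le ((Complex.abs_re_le_norm _).trans_eq (norm_mFourier_apply k x))]

lemma exists_continuousMap_eq_cusp (d : ℕ) {α : ℝ} (hα : 0 < α) :
    ∃ F : C(Torus d, ℂ), (∀ x, F x = cusp d α x) ∧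
      ∀ k ≠ 0, mFourierCoeff F k = -(‖k‖ ^ (-(d + α)) : ℝ) := by
  let c (k : Fin d → ℤ) : ℂ := (‖k‖ ^ (-(d + α)) : ℝ)
  have hc : Summable fun k => ‖c k‖ := by
    simpa only [c, Complex.norm_real] using
      (summable_norm_rpow_neg (ι := Fin d) (t := d + α) (by simpa using hα)).norm
  have hsingle : HasSum (Pi.single (0 : Fin d → ℤ) (∑' k, c k)) (∑' k, c k) :=
    hasSum_pi_single 0 _
  obtain ⟨F, hF, hFsum⟩ :=
    exists_continuousMap_hasSum_mFourier (hsingle.summable.sub hc.of_norm).norm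
  refine ⟨F, fun x => ?_, fun k hk => ?_⟩
  · have hre := hasSum_mul_re_mFourier (fun k => ?_) (hFsum x)
    · have hcusp := (Complex.hasSum_ofReal.mpr (hasSum_cusp hα x)).add hsingle
        |>.sub hc.of_norm.hasSum
      rw [add_sub_cancel_right] at hcusp
      refine hre.unique (hcusp.congr_fun fun k => ?_)
      rcases eq_or_ne k 0 with rfl | hk
      · simp [c, mFourier_zero]
      · simp only [Pi.single_eq_of_ne hk, c]
        push_cast
        ring
    · simp [c, Pi.single_apply]
  · simp [hF, c, hk]

lemma continuous_cusp (d : ℕ) {α : ℝ} (hα : 0 < α) : Continuous (cusp d α) := by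
  obtain ⟨F, hF, -⟩ := exists_continuousMap_eq_cusp d hα
  have : cusp d α = fun x => (F x).re := funext fun x => by rw [hF, Complex.ofReal_re]
  rw [this]
  fun_prop

lemma memSobolev_cusp {d : ℕ} {s α : ℝ} (hs : 0 < s) (hα : 0 < α) (hsα : s - d / 2 < α) :
    MemSobolev s fun x => (cusp d α x : ℂ) := by
  obtain ⟨F, hF, hFk⟩ := exists_continuousMap_eq_cusp d hα
  simp only [← hF]
  refine memSobolev_of_norm_mFourierCoeff_le (t := d + α) (C := 1) hs (by linarith)
    (F.continuous.memLp_of_hasCompactSupport (.of_compactSpace F)) fun k hk => ?_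
  rw [hFk k hk, norm_neg, Complex.norm_real, Real.norm_of_nonneg (by positivity), one_mul]

lemma four_mul_norm_le_norm_fourier_one_sub_one (z : UnitAddCircle) :
    4 * ‖z‖ ≤ ‖fourier 1 z - 1‖ := by
  obtain ⟨t, rfl, ht⟩ := exists_coe_eq_abs_eq_norm z
  have hhalf : |t| ≤ 1 / 2 := by
    rw [ht]
    simpa using AddCircle.norm_le_half_period (1 : ℝ) (x := (t : UnitAddCircle)) one_ne_zero
  have hexp : fourier 1 (t : UnitAddCircle)
      = Complex.exp (Complex.I * ((2 * Real.pi * t : ℝ) : ℂ)) := by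
    rw [fourier_coe_apply]
    congr 1
    push_cast; ring
  have habs : |2 * Real.pi * t / 2| = Real.pi * |t| := by
    rw [mul_assoc, mul_div_cancel_left₀ _ two_ne_zero, abs_mul, abs_of_pos Real.pi_pos]
  have hsin : 2 / Real.pi * |2 * Real.pi * t / 2| ≤ |Real.sin (2 * Real.pi * t / 2)| :=
    Real.mul_abs_le_abs_sin (by rw [habs]; nlinarith [Real.pi_pos])
  rw [habs, ← mul_assoc, div_mul_cancel₀ _ Real.pi_ne_zero] at hsin
  rw [hexp, Complex.norm_exp_I_mul_ofReal_sub_one, ← ht, norm_mul, Real.norm_ofNat,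
    Real.norm_eq_abs]
  linarith

lemma norm_sum_range_fourier_le (z : UnitAddCircle) (N : ℕ) :
    ‖∑ m ∈ Finset.range N, fourier (m : ℤ) z‖ ≤ N := by
  refine (norm_sum_le _ _).trans_eq ?_
  simp only [fourier_apply, Circle.norm_coe, Finset.sum_const, Finset.card_range, nsmul_eq_mul,
    mul_one]

lemma norm_mul_norm_sum_range_fourier_le (z : UnitAddCircle) (N : ℕ) :
    2 * ‖z‖ * ‖∑ m ∈ Finset.range N, fourier (m : ℤ) z‖ ≤ 1 := by
  have hpow (m : ℕ) : fourier (m : ℤ) z = fourier 1 z ^ m := by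
    rw [fourier_apply, fourier_one, natCast_zsmul, AddCircle.toCircle_nsmul, Circle.coe_pow]
  have hgeom := congrArg norm (mul_geom_sum (fourier 1 z) N)
  simp only [← hpow, norm_mul] at hgeom
  have htwo : ‖fourier (N : ℤ) z - 1‖ ≤ 2 := by
    refine (norm_sub_le _ _).trans_eq ?_
    rw [fourier_apply, Circle.norm_coe, norm_one, one_add_one_eq_two]
  nlinarith [four_mul_norm_le_norm_fourier_one_sub_one z,
    norm_nonneg (∑ m ∈ Finset.range N, fourier (m : ℤ) z)]

/-- The box `{0, …, N - 1}^ι` in `ℤ^ι`. The Fourier characters of its points add up to a product of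
one-dimensional geometric sums. -/
def latticeBox (ι : Type*) [Fintype ι] [DecidableEq ι] (N : ℕ) : Finset (ι → ℤ) :=
  Fintype.piFinset fun _ => (Finset.range N).map Nat.castEmbedding

section LatticeBox

variable {ι : Type*} [Fintype ι] [DecidableEq ι] {N : ℕ}

lemma norm_le_of_mem_latticeBox {k : ι → ℤ} (hk : k ∈ latticeBox ι N) : ‖k‖ ≤ N := by
  refine (pi_norm_le_iff_of_nonneg (by positivity)).mpr fun i => ?_
  obtain ⟨m, hm, hmk⟩ := Finset.mem_map.mp (Fintype.mem_piFinset.mp hk i)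
  rw [← hmk, Nat.castEmbedding_apply, Int.norm_natCast]
  exact_mod_cast (Finset.mem_range.mp hm).le

lemma card_latticeBox : (latticeBox ι N).card = N ^ Fintype.card ι := by
  simp only [latticeBox, Fintype.card_piFinset, Finset.card_map, Finset.card_range,
    Finset.prod_const, Finset.card_univ]

lemma sum_latticeBox_mFourier (x : UnitAddTorus ι) :
    ∑ k ∈ latticeBox ι N, mFourier k x = ∏ i, ∑ m ∈ Finset.range N, fourier (m : ℤ) (x i) := by
  have h := Finset.prod_univ_sum (fun _ : ι => (Finset.range N).map Nat.castEmbedding)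
    (fun i (m : ℤ) => fourier m (x i))
  simp only [Finset.sum_map, Nat.castEmbedding_apply] at h
  rw [h]
  rfl

lemma norm_sum_latticeBox_mFourier_le {x : UnitAddTorus ι} (hx : x ≠ 0) (hN : ‖x‖⁻¹ ≤ N) :
    ‖∑ k ∈ latticeBox ι N, mFourier k x‖ ≤ (N : ℝ) ^ Fintype.card ι / 2 := by
  have hx0 : 0 < ‖x‖ := norm_pos_iff.mpr hx
  obtain ⟨j, -⟩ := Function.ne_iff.mp hx
  obtain ⟨i, -, hi⟩ := Finset.exists_mem_eq_sup Finset.univ ⟨j, Finset.mem_univ j⟩ fun i => ‖x i‖₊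
  replace hi : ‖x i‖ = ‖x‖ := congrArg NNReal.toReal hi.symm
  have hfactor : ‖∑ m ∈ Finset.range N, fourier (m : ℤ) (x i)‖ ≤ N / 2 := by
    have hgeom := norm_mul_norm_sum_range_fourier_le (x i) N
    rw [hi, mul_right_comm, ← le_div_iff₀ hx0, one_div] at hgeom
    linarith
  rw [sum_latticeBox_mFourier, norm_prod, ← Finset.mul_prod_erase _ _ (Finset.mem_univ i)]
  calc _ ≤ (N / 2 : ℝ) * ∏ _j ∈ Finset.univ.erase i, (N : ℝ) := by
        gcongr with j _
        exact norm_sum_range_fourier_le (x j) N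
    _ = (∏ _j : ι, (N : ℝ)) / 2 := by
        rw [div_mul_eq_mul_div, Finset.mul_prod_erase _ (fun _ => (N : ℝ)) (Finset.mem_univ i)]
    _ = (N : ℝ) ^ Fintype.card ι / 2 := by rw [Finset.prod_const, Finset.card_univ]

lemma le_sum_latticeBox_one_sub_re_mFourier {x : UnitAddTorus ι} (hx : x ≠ 0) (hN : ‖x‖⁻¹ ≤ N) :
    (N : ℝ) ^ Fintype.card ι / 2 ≤ ∑ k ∈ latticeBox ι N, (1 - (mFourier k x).re) := by
  rw [Finset.sum_sub_distrib, Finset.sum_const, card_latticeBox, ← Complex.re_sum, nsmul_eq_mul,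
    mul_one, Nat.cast_pow]
  linarith [(Complex.re_le_norm _).trans (norm_sum_latticeBox_mFourier_le hx hN)]

end LatticeBox

lemma rpow_mul_sum_latticeBox_le_cusp {d : ℕ} {α : ℝ} (hα : 0 < α) (N : ℕ) (x : Torus d) :
    (N : ℝ) ^ (-(d + α)) * ∑ k ∈ latticeBox (Fin d) N, (1 - (mFourier k x).re) ≤ cusp d α x := by
  have hnonneg (k : Fin d → ℤ) : 0 ≤ 1 - (mFourier k x).re :=
    sub_nonneg.mpr (re_mFourier_le_one k x)
  rw [Finset.mul_sum]
  refine le_trans (Finset.sum_le_sum fun k hk => ?_) (sum_le_hasSum (latticeBox (Fin d) N)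
    (fun k _ => mul_nonneg (by positivity) (hnonneg k)) (hasSum_cusp hα x))
  rcases eq_or_ne k 0 with rfl | hk0
  · simp [mFourier_zero]
  · refine mul_le_mul_of_nonneg_right ?_ (hnonneg k)
    exact Real.rpow_le_rpow_of_nonpos (norm_pos_iff.mpr hk0) (norm_le_of_mem_latticeBox hk)
      (by linarith [(Nat.cast_nonneg d : (0 : ℝ) ≤ d)])

lemma mul_norm_rpow_le_cusp {d : ℕ} {α : ℝ} (hα : 0 < α) (x : Torus d) :
    1 / 2 * (1 / 2) ^ α * ‖x‖ ^ α ≤ cusp d α x := by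
  rcases eq_or_ne x 0 with rfl | hx
  · rw [norm_zero, Real.zero_rpow hα.ne', mul_zero]
    exact cusp_nonneg d α 0
  have hx0 : 0 < ‖x‖ := norm_pos_iff.mpr hx
  have hx1 : ‖x‖ ≤ 1 := (pi_norm_le_iff_of_nonneg zero_le_one).mpr fun i =>
    (AddCircle.norm_le_half_period (1 : ℝ) one_ne_zero).trans (by norm_num)
  set N := ⌈‖x‖⁻¹⌉₊
  have hN : ‖x‖⁻¹ ≤ N := Nat.le_ceil _
  have hN0 : (0 : ℝ) < N := (inv_pos.mpr hx0).trans_le hN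
  have hN2 : (N : ℝ) ≤ 2 * ‖x‖⁻¹ := by
    linarith [Nat.ceil_lt_add_one (inv_pos.mpr hx0).le, (one_le_inv₀ hx0).mpr hx1]
  calc 1 / 2 * (1 / 2) ^ α * ‖x‖ ^ α = 1 / 2 * (2 * ‖x‖⁻¹) ^ (-α) := by
        rw [mul_assoc, ← Real.mul_rpow (by norm_num) hx0.le, Real.rpow_neg (by positivity),
          ← Real.inv_rpow (by positivity), mul_inv, inv_inv, one_div]
    _ ≤ 1 / 2 * (N : ℝ) ^ (-α) := by
        gcongr 1 / 2 * ?_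
        exact Real.rpow_le_rpow_of_nonpos hN0 hN2 (by linarith)
    _ = (N : ℝ) ^ (-(d + α)) * ((N : ℝ) ^ d / 2) := by
        rw [neg_add, Real.rpow_add hN0, Real.rpow_neg hN0.le d, Real.rpow_natCast]
        field_simp
    _ ≤ (N : ℝ) ^ (-(d + α)) * ∑ k ∈ latticeBox (Fin d) N, (1 - (mFourier k x).re) := by
        gcongr
        simpa using le_sum_latticeBox_one_sub_re_mFourier hx hN
    _ ≤ cusp d α x := rpow_mul_sum_latticeBox_le_cusp hα N x

lemma integrable_norm_rpow_unitAddCircle {γ : ℝ} (hγ : γ < 1) :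
    Integrable (fun z : UnitAddCircle => ‖z‖ ^ (-γ)) AddCircle.haarAddCircle := by
  have hmeas : Measurable fun z : UnitAddCircle => ‖z‖ ^ (-γ) := by fun_prop
  rw [haarAddCircle_eq_volume, ← (AddCircle.measurePreserving_mk (1 : ℝ) (-(1 / 2))).integrable_comp
    hmeas.aestronglyMeasurable]
  have hright : IntervalIntegrable (fun t : ℝ => |t| ^ (-γ)) volume 0 (1 / 2) := by
    refine (intervalIntegral.intervalIntegrable_rpow' (by linarith : -1 < -γ)).congr fun t ht => ?_
    rw [Set.uIoc_of_le (by norm_num)] at ht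
    simp only [abs_of_pos ht.1]
  have hleft : IntervalIntegrable (fun t : ℝ => |t| ^ (-γ)) volume (-(1 / 2)) 0 := by
    rw [IntervalIntegrable.iff_comp_neg]
    simpa using hright.symm
  have hIoc := (intervalIntegrable_iff_integrableOn_Ioc_of_le (by norm_num)).mp (hleft.trans hright)
  rw [show -(1 / 2 : ℝ) + 1 = 1 / 2 by norm_num]
  refine hIoc.congr_fun (fun t ht => ?_) measurableSet_Ioc
  rw [Function.comp_apply, (AddCircle.norm_coe_eq_abs_iff (1 : ℝ) one_ne_zero).mpr]
  rw [abs_le, abs_one]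
  exact ⟨ht.1.le, ht.2⟩

instance nullSingletonClass_haarAddCircle :
    NullSingletonClass (AddCircle.haarAddCircle : Measure UnitAddCircle) where
  measure_singleton x := by
    rw [haarAddCircle_eq_volume, ← Metric.closedBall_zero, AddCircle.volume_closedBall]
    simp

lemma ae_forall_apply_ne_zero (d : ℕ) : ∀ᵐ x ∂torusMeasure d, ∀ i, x i ≠ 0 :=
  ae_all_iff.mpr fun i => Measure.ae_eval_ne (μ := fun _ : Fin d => AddCircle.haarAddCircle) i 0

lemma integrable_norm_rpow_torus {d : ℕ} {t : ℝ} (ht0 : 0 ≤ t) (ht : t < d) :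
    Integrable (fun x : Torus d => ‖x‖ ^ (-t)) (torusMeasure d) := by
  have hd : (0 : ℝ) < d := ht0.trans_lt ht
  have hprod : Integrable (fun x : Torus d => ∏ i, ‖x i‖ ^ (-(t / d))) (torusMeasure d) :=
    Integrable.fintype_prod (f := fun _ (z : UnitAddCircle) => ‖z‖ ^ (-(t / d)))
      fun _ => integrable_norm_rpow_unitAddCircle (by rwa [div_lt_one hd])
  have hmeas : Measurable fun x : Torus d => ‖x‖ ^ (-t) := by fun_prop
  refine hprod.mono' hmeas.aestronglyMeasurable ?_
  filter_upwards [ae_forall_apply_ne_zero d] with x hx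
  have hxi (i : Fin d) : 0 < ‖x i‖ := norm_pos_iff.mpr (hx i)
  rw [Real.norm_of_nonneg (by positivity)]
  calc ‖x‖ ^ (-t) = ∏ _i : Fin d, ‖x‖ ^ (-(t / d)) := by
        rw [Finset.prod_const, Finset.card_univ, Fintype.card_fin,
          ← Real.rpow_mul_natCast (norm_nonneg x), neg_mul, div_mul_cancel₀ _ hd.ne']
    _ ≤ ∏ i, ‖x i‖ ^ (-(t / d)) := Finset.prod_le_prod (fun _ _ => by positivity) fun i _ =>
        Real.rpow_le_rpow_of_nonpos (hxi i) (norm_le_pi_norm x i)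
          (neg_nonpos.mpr (div_nonneg ht0 hd.le))

lemma ae_cusp_pos {d : ℕ} (hd : 0 < d) {α : ℝ} (hα : 0 < α) :
    ∀ᵐ x ∂torusMeasure d, 0 < cusp d α x := by
  filter_upwards [ae_forall_apply_ne_zero d] with x hx
  have hx0 : 0 < ‖x‖ := norm_pos_iff.mpr fun h => hx ⟨0, hd⟩ (congrFun h _)
  exact lt_of_lt_of_le (by positivity) (mul_norm_rpow_le_cusp hα x)

lemma memLp_inv_cusp {d : ℕ} {α p : ℝ} (hα : 0 < α) (hp : 0 < p) (hαp : α * p < d) :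
    MemLp (fun x => ((cusp d α x : ℂ))⁻¹) (ENNReal.ofReal p) (torusMeasure d) := by
  have hd : 0 < d := by exact_mod_cast (by positivity : 0 < α * p).trans hαp
  have hmeas : Measurable fun x => ((cusp d α x : ℂ))⁻¹ :=
    (Complex.measurable_ofReal.comp (continuous_cusp d hα).measurable).inv
  rw [← integrable_norm_rpow_iff hmeas.aestronglyMeasurable (by simpa using hp)
    ENNReal.ofReal_ne_top, ENNReal.toReal_ofReal hp.le]
  refine ((integrable_norm_rpow_torus (by positivity) hαp).const_mul
    ((1 / 2 * (1 / 2) ^ α)⁻¹ ^ p)).mono' (hmeas.norm.pow_const p).aestronglyMeasurable ?_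
  filter_upwards [ae_forall_apply_ne_zero d] with x hx
  have hx0 : 0 < ‖x‖ := norm_pos_iff.mpr fun h => hx ⟨0, hd⟩ (congrFun h _)
  rw [Real.norm_of_nonneg (by positivity), norm_inv, Complex.norm_real,
    Real.norm_of_nonneg (cusp_nonneg d α x)]
  calc (cusp d α x)⁻¹ ^ p ≤ (1 / 2 * (1 / 2) ^ α * ‖x‖ ^ α)⁻¹ ^ p := by
        gcongr
        · exact inv_nonneg.mpr (cusp_nonneg d α x)
        · exact mul_norm_rpow_le_cusp hα x
    _ = (1 / 2 * (1 / 2) ^ α)⁻¹ ^ p * ‖x‖ ^ (-(α * p)) := by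
        rw [mul_inv, Real.mul_rpow (by positivity) (by positivity), ← Real.rpow_neg hx0.le,
          ← Real.rpow_mul hx0.le, neg_mul]

lemma eigenvalueDesc_smul_one {K : ℕ} (t : ℝ) (k : Fin K) :
    eigenvalueDesc ((t : ℂ) • (1 : Matrix (Fin K) (Fin K) ℂ)) k = t := by
  obtain ⟨v, hv, hvk⟩ := exists_mulVec_eq_eigenvalueDesc
    (Matrix.isHermitian_one.smul (Complex.conj_ofReal t)) k
  rw [Matrix.smul_mulVec, Matrix.one_mulVec] at hvk
  exact_mod_cast (smul_left_injective ℂ hv hvk).symm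

lemma MemSobolev.const_mul {d : ℕ} {s : ℝ} {w : Torus d → ℂ} (hw : MemSobolev s w) (c : ℂ) :
    MemSobolev s fun x => c * w x := by
  have hcoeff (k : Fin d → ℤ) : mFourierCoeff (fun x => c * w x) k = c * mFourierCoeff w k := by
    simp only [mFourierCoeff_eq, smul_eq_mul, mul_left_comm _ c, integral_const_mul]
  refine ⟨hw.1.const_mul c, (hw.2.mul_left (‖c‖ ^ 2)).congr fun k => ?_⟩
  rw [hcoeff, norm_mul, mul_pow]
  ring

section ScalarMatrix

variable {d : ℕ} {s : ℝ} {w : Torus d → ℝ}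

lemma MemSobolev.hermitianWithSobolevEigenvalues_smul_one (hw : MemSobolev s fun x => (w x : ℂ))
    (K : ℕ) :
    HermitianWithSobolevEigenvalues s fun x => (w x : ℂ) • (1 : Matrix (Fin K) (Fin K) ℂ) := by
  refine ⟨fun i j => ?_,
    ae_of_all _ fun x => Matrix.isHermitian_one.smul (Complex.conj_ofReal (w x)), fun k => ?_⟩
  · simpa only [Matrix.smul_apply, smul_eq_mul] using
      (hw.1.integrable one_le_two).mul_const ((1 : Matrix (Fin K) (Fin K) ℂ) i j)
  · simpa only [eigenvalueDesc_smul_one] using hw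

lemma MemSobolev.nonnegWithSobolevEntries_smul_one (hw : MemSobolev s fun x => (w x : ℂ))
    (hw0 : ∀ x, 0 ≤ w x) (K : ℕ) :
    NonnegWithSobolevEntries s fun x => (w x : ℂ) • (1 : Matrix (Fin K) (Fin K) ℂ) := by
  refine ⟨ae_of_all _ fun x => Matrix.PosSemidef.one.smul (by exact_mod_cast hw0 x), fun i j => ?_⟩
  simpa only [Matrix.smul_apply, smul_eq_mul, mul_comm] using
    hw.const_mul ((1 : Matrix (Fin K) (Fin K) ℂ) i j)

end ScalarMatrix

lemma hasZero_det_smul_one {d K : ℕ} (hK : K ≠ 0) {w : Torus d → ℂ} (hw : Continuous w)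
    {x₀ : Torus d} (hx₀ : w x₀ = 0) :
    HasZero fun x => (w x • (1 : Matrix (Fin K) (Fin K) ℂ)).det := by
  simp only [Matrix.det_smul, Matrix.det_one, Fintype.card_fin, mul_one]
  exact ⟨_, hw.pow K, ae_eq_refl _, x₀, by rw [Pi.pow_apply, hx₀, zero_pow hK]⟩

lemma inverseIsMultiplier_cusp_smul_one {d : ℕ} (K : ℕ) {α : ℝ} {q : ℝ≥0∞} (hα : 0 < α)
    (hq : 2 ≤ q) (hαq : α < d / 2 - d * q⁻¹.toReal) :
    InverseIsMultiplier q fun x => (cusp d α x : ℂ) • (1 : Matrix (Fin K) (Fin K) ℂ) := by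
  have hd : 0 < (d : ℝ) := by
    refine (Nat.cast_nonneg d).lt_of_ne fun h => ?_
    rw [← h] at hαq
    linarith
  obtain ⟨r, hr, hrq⟩ : ∃ r, α / d < r ∧ r < 1 / 2 - q⁻¹.toReal := by
    refine exists_between ((div_lt_iff₀ hd).mpr ?_)
    linarith
  have hr0 : 0 < r := lt_trans (by positivity) hr
  have hr2 : r < 1 / 2 := by linarith [(ENNReal.toReal_nonneg : 0 ≤ q⁻¹.toReal)]
  have hLp : MemLp (fun x => ((cusp d α x : ℂ))⁻¹) (ENNReal.ofReal r⁻¹) (torusMeasure d) := by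
    refine memLp_inv_cusp hα (by positivity) ?_
    rwa [← div_eq_mul_inv, div_lt_comm₀ hr0 hd]
  have hL2 : MemLp (fun x => ((cusp d α x : ℂ))⁻¹) 2 (torusMeasure d) := by
    refine hLp.mono_exponent ?_
    rw [← ENNReal.ofReal_ofNat]
    exact ENNReal.ofReal_le_ofReal ((le_inv_comm₀ two_pos hr0).mpr (by linarith))
  obtain ⟨C, hC, hu⟩ := exists_isScalarMultiplierWith_of_memLp hq (inv_pos.mpr hr0)
    (by rwa [inv_inv]) hLp
  refine ⟨_, ?_, hu.isMatrixMultiplier_smul_one (le_trans (by norm_num) hq) hC hL2 K⟩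
  filter_upwards [ae_cusp_pos (by exact_mod_cast hd) hα] with x hx
  rw [smul_mul_smul_comm, mul_one, mul_inv_cancel₀ (by exact_mod_cast hx.ne'), one_smul]

lemma exists_inverseIsMultiplier {d : ℕ} (K : ℕ) (hK : K ≠ 0) {s : ℝ} {q : ℝ≥0∞}
    (hs : (d : ℝ) / 2 < s) (hq : 2 ≤ q) (hqs : s - d / 2 < d / 2 - d * q⁻¹.toReal) :
    ∃ W : Torus d → Matrix (Fin K) (Fin K) ℂ,
      HermitianWithSobolevEigenvalues s W ∧ NonnegWithSobolevEntries s W ∧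
        HasZero (fun x => (W x).det) ∧ InverseIsMultiplier q W := by
  obtain ⟨α, hsα, hαq⟩ := exists_between hqs
  have hα : 0 < α := by linarith
  have hs0 : 0 < s := (by positivity : (0 : ℝ) ≤ d / 2).trans_lt hs
  have hw := memSobolev_cusp hs0 hα hsα
  exact ⟨_, hw.hermitianWithSobolevEigenvalues_smul_one K,
    hw.nonnegWithSobolevEntries_smul_one (cusp_nonneg d α) K,
    hasZero_det_smul_one hK (Complex.continuous_ofReal.comp (continuous_cusp d hα)) (x₀ := 0)
      (by simp [cusp_zero]),
    inverseIsMultiplier_cusp_smul_one K hα hq hαq⟩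

section ConjugateExponent

variable {a r : ℝ} {q : ℝ≥0∞}

lemma le_ofReal_div_ofReal_iff (ha : 0 < a) (hq : q ≠ 0) :
    q ≤ ENNReal.ofReal a / ENNReal.ofReal r ↔ r ≤ a * q⁻¹.toReal := by
  have ha0 : ENNReal.ofReal a ≠ 0 := (ENNReal.ofReal_pos.mpr ha).ne'
  have hatop : ENNReal.ofReal a ≠ ⊤ := ENNReal.ofReal_ne_top
  rw [← ENNReal.inv_le_inv, ENNReal.inv_div (.inl ENNReal.ofReal_ne_top) (.inr ha0),
    ENNReal.div_le_iff' ha0 hatop,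
    ENNReal.ofReal_le_iff_le_toReal (ENNReal.mul_ne_top hatop (ENNReal.inv_ne_top.mpr hq)),
    ENNReal.toReal_mul, ENNReal.toReal_ofReal ha.le]

lemma lt_ofReal_div_ofReal_iff (ha : 0 < a) (hr : 0 ≤ r) (hq : q ≠ 0) :
    q < ENNReal.ofReal a / ENNReal.ofReal r ↔ r < a * q⁻¹.toReal := by
  have ha0 : ENNReal.ofReal a ≠ 0 := (ENNReal.ofReal_pos.mpr ha).ne'
  have hatop : ENNReal.ofReal a ≠ ⊤ := ENNReal.ofReal_ne_top
  rw [← ENNReal.inv_lt_inv, ENNReal.inv_div (.inl ENNReal.ofReal_ne_top) (.inr ha0),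
    ENNReal.div_lt_iff (.inl ha0) (.inl hatop), mul_comm,
    ENNReal.ofReal_lt_iff_lt_toReal hr (ENNReal.mul_ne_top hatop (ENNReal.inv_ne_top.mpr hq)),
    ENNReal.toReal_mul, ENNReal.toReal_ofReal ha.le]

end ConjugateExponent

lemma HermitianWithSobolevEigenvalues.mono {d K : ℕ} {s t : ℝ} (ht : 0 < t) (hts : t ≤ s)
    {W : Torus d → Matrix (Fin K) (Fin K) ℂ} (hW : HermitianWithSobolevEigenvalues s W) :
    HermitianWithSobolevEigenvalues t W :=
  ⟨hW.1, hW.2.1, fun k => (hW.2.2 k).mono ht hts⟩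

lemma exists_lt_lt_half_add_one {d s : ℝ} {q : ℝ≥0∞} (hsd : s ≤ d)
    (hs1 : s = d / 2 + 1) (hq : 2 ≤ q)
    (hqs : q < ENNReal.ofReal (2 * d) / ENNReal.ofReal (d - 2)) :
    ∃ t, d / 2 < t ∧ t < d / 2 + 1 ∧ t ≤ s ∧ d / 2 - d * q⁻¹.toReal ≤ t - d / 2 := by
  rw [lt_ofReal_div_ofReal_iff (by linarith) (by linarith) (two_pos.trans_le hq).ne'] at hqs
  obtain ⟨t, ht, hts⟩ : ∃ t, max (d / 2) (d - d * q⁻¹.toReal) < t ∧ t < d / 2 + 1 :=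
    exists_between (max_lt (by linarith) (by linarith))
  obtain ⟨htd, htq⟩ := max_lt_iff.mp ht
  exact ⟨t, htd, hts, by linarith, by linarith⟩

lemma sub_half_lt_of_ofReal_div_ofReal_lt {d s : ℝ} {q : ℝ≥0∞} (hs : d / 2 < s) (hsd : s ≤ d)
    (hqs : ENNReal.ofReal d / ENNReal.ofReal (d - s) < q) :
    2 ≤ q ∧ s - d / 2 < d / 2 - d * q⁻¹.toReal := by
  have hd : 0 < d := by linarith
  have htwo : 2 ≤ ENNReal.ofReal d / ENNReal.ofReal (d - s) := by
    rw [le_ofReal_div_ofReal_iff hd two_ne_zero, ENNReal.toReal_inv, ENNReal.toReal_ofNat]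
    linarith
  have hq : 2 ≤ q := htwo.trans hqs.le
  rw [← not_le, le_ofReal_div_ofReal_iff hd (two_pos.trans_le hq).ne'] at hqs
  exact ⟨hq, by linarith⟩

lemma half_sub_le_of_le_ofReal_div_ofReal {d s : ℝ} {q : ℝ≥0∞} (hd : 0 < d) (hq : 2 ≤ q)
    (hqs : q ≤ ENNReal.ofReal d / ENNReal.ofReal (d - s)) :
    d / 2 - d * q⁻¹.toReal ≤ s - d / 2 := by
  have := (le_ofReal_div_ofReal_iff hd (two_pos.trans_le hq).ne').mp hqs
  linarith

end SobolevMultiplier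

end

theorem corollary1p4 (d K : ℕ) (hK : 1 ≤ K) (s : ℝ) (hs : (d : ℝ) / 2 < s) (hsd : s ≤ d) :
    -- Hermitian matrix functions with eigenvalues in `W^{s,2}`
    ((s < (d : ℝ) / 2 + 1 →
        (∀ W : Torus d → Matrix (Fin K) (Fin K) ℂ,
          HermitianWithSobolevEigenvalues s W → HasZero (fun x => (W x).det) →
          ∀ q : ℝ≥0∞, 2 ≤ q → q ≤ ENNReal.ofReal d / ENNReal.ofReal (d - s) →
            ¬ InverseIsMultiplier q W) ∧
        (∀ q : ℝ≥0∞, ENNReal.ofReal d / ENNReal.ofReal (d - s) < q →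
          ∃ W : Torus d → Matrix (Fin K) (Fin K) ℂ,
            HermitianWithSobolevEigenvalues s W ∧ HasZero (fun x => (W x).det) ∧
            InverseIsMultiplier q W)) ∧
      (s = (d : ℝ) / 2 + 1 →
        ∀ W : Torus d → Matrix (Fin K) (Fin K) ℂ,
          HermitianWithSobolevEigenvalues s W → HasZero (fun x => (W x).det) →
          ∀ q : ℝ≥0∞, 2 ≤ q → q < ENNReal.ofReal (2 * d) / ENNReal.ofReal (d - 2) →
            ¬ InverseIsMultiplier q W)) ∧
    -- nonnegative matrix functions with entries in `W^{s,2}`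
    ((s < (d : ℝ) / 2 + 1 →
        (∀ W : Torus d → Matrix (Fin K) (Fin K) ℂ,
          NonnegWithSobolevEntries s W → HasZero (fun x => (W x).det) →
          ∀ q : ℝ≥0∞, 2 ≤ q → q ≤ ENNReal.ofReal d / ENNReal.ofReal (d - s) →
            ¬ InverseIsMultiplier q W) ∧
        (∀ q : ℝ≥0∞, ENNReal.ofReal d / ENNReal.ofReal (d - s) < q →
          ∃ W : Torus d → Matrix (Fin K) (Fin K) ℂ,
            NonnegWithSobolevEntries s W ∧ HasZero (fun x => (W x).det) ∧
            InverseIsMultiplier q W)) ∧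
      (s = (d : ℝ) / 2 + 1 →
        ∀ W : Torus d → Matrix (Fin K) (Fin K) ℂ,
          NonnegWithSobolevEntries s W → HasZero (fun x => (W x).det) →
          ∀ q : ℝ≥0∞, 2 ≤ q → q < ENNReal.ofReal (2 * d) / ENNReal.ofReal (d - 2) →
            ¬ InverseIsMultiplier q W)) := by
  have hd : (0 : ℝ) < d := by linarith
  have hK0 : K ≠ 0 := Nat.one_le_iff_ne_zero.mp hK
  have hsd' : 0 ≤ s - d / 2 := by linarith
  refine ⟨⟨fun hs1 => ⟨fun W hW hdet q hq hqs => ?_, fun q hqs => ?_⟩,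
      fun hs1 W hW hdet q hq hqs => ?_⟩,
    ⟨fun hs1 => ⟨fun W hW hdet q hq hqs => ?_, fun q hqs => ?_⟩,
      fun hs1 W hW hdet q hq hqs => ?_⟩⟩
  · obtain ⟨x₀, hx₀⟩ := hW.exists_degeneratesAt hs hs1 hdet
    exact hx₀.not_inverseIsMultiplier hsd' (one_le_two.trans hq)
      (half_sub_le_of_le_ofReal_div_ofReal hd hq hqs)
  · obtain ⟨hq, hsq⟩ := sub_half_lt_of_ofReal_div_ofReal_lt hs hsd hqs
    obtain ⟨W, hW, -, hdet, hinv⟩ := exists_inverseIsMultiplier K hK0 hs hq hsq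
    exact ⟨W, hW, hdet, hinv⟩
  · obtain ⟨t, ht, ht1, hts, htq⟩ := exists_lt_lt_half_add_one hsd hs1 hq hqs
    obtain ⟨x₀, hx₀⟩ := (hW.mono (by linarith) hts).exists_degeneratesAt ht ht1 hdet
    exact hx₀.not_inverseIsMultiplier (by linarith) (one_le_two.trans hq) htq
  · obtain ⟨x₀, hx₀⟩ := exists_degeneratesAt_of_memSobolev_entries hs hs1 hW.2 hdet
    exact hx₀.not_inverseIsMultiplier hsd' (one_le_two.trans hq)
      (half_sub_le_of_le_ofReal_div_ofReal hd hq hqs)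
  · obtain ⟨hq, hsq⟩ := sub_half_lt_of_ofReal_div_ofReal_lt hs hsd hqs
    obtain ⟨W, -, hW, hdet, hinv⟩ := exists_inverseIsMultiplier K hK0 hs hq hsq
    exact ⟨W, hW, hdet, hinv⟩
  · obtain ⟨t, ht, ht1, hts, htq⟩ := exists_lt_lt_half_add_one hsd hs1 hq hqs
    obtain ⟨x₀, hx₀⟩ := exists_degeneratesAt_of_memSobolev_entries ht ht1
      (fun i j => (hW.2 i j).mono (by linarith) hts) hdet
    exact hx₀.not_inverseIsMultiplier (by linarith) (one_le_two.trans hq) htq
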